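/- Let $(M,g)$ be a (non-empty) closed, i.e. compact without boundary, smooth Riemannian four-manifold, with volume element $dv$, Weyl tensor $W$ (with $|W|^2=W_{ijkl}W^{ijkl}$), Ricci tensor $Ric$, scalar curvature $R$, Laplace–Beltrami operator $\Delta$ (the trace of the Hessian) and $Q$-curvature $$Q=\tfrac1{12}\left(-\Delta R+R^2-3|Ric|^2\right).$$ Let $\int wPw\,dv$ be the quadratic form of the Paneitz operator $P=\Delta^2+\delta\left(\tfrac23Rg-2Ric\right)\circ\nabla$, read for $w\in W^{2,2}(M)$ as $$\int wPw\,dv=\int\left((\Delta w)^2+\tfrac23R|\nabla w|^2-2\,Ric(\nabla w,\nabla w)\right)dv .$$ For $w\in W^{2,2}(M)$ put $$I[w]=4\int w|W|^2\,dv-\left(\int|W|^2\,dv\right)\log\frac{\int e^{4w}\,dv}{\mathrm{Vol}(M)},$$ $$II[w]=\int wPw\,dv+4\int Qw\,dv-\left(\int Q\,dv\right)\log\frac{\int e^{4w}\,dv}{\mathrm{Vol}(M)},$$ $$III[w]=12\int\left(\Delta w+|\nabla w|^2\right)^2dv-4\int\left(w\,\Delta R+R|\nabla w|^2\right)dv,$$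 and define the Branson–Ørsted functionals of the log-determinant of the Paneitz operator and of Cheeger's half-torsion by $$F_P=-\tfrac14\,I-14\,II+\tfrac83\,III,\qquad F_\tau=-13\,I-248\,II+\tfrac{116}3\,III .$$ **Theorem.** One has $$\inf_{w\in W^{2,2}(M)}F_P[w]=-\infty,\qquad \sup_{w\in W^{2,2}(M)}F_P[w]=+\infty,$$ and the same holds for $F_\tau$. All four equalities also hold if $II$ is replaced by $$II'[w]=\int wPw\,dv-\left(\int Q\,dv\right)\log\frac{\int e^{4(w-\overline w)}\,dv}{\mathrm{Vol}(M)},\qquad \overline w=\frac{\int w\,dv}{\mathrm{Vol}(M)},$$ which agrees with $II$ when $Q$ is constant. -/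

import Mathlib

open scoped Manifold ContDiff

namespace ConformalFour

noncomputable section

/-! ### Riemannian geometry in a coordinate domain of `ℝ⁴`

A metric is given by its matrix `G u = (g_ij(u))`; all formulas are the classical ones. -/

/-- The model space `ℝ⁴`. -/
abbrev E4 : Type := EuclideanSpace ℝ (Fin 4)

/-- The `i`-th coordinate partial derivative `∂_i f`. -/
def pd (i : Fin 4) (f : E4 → ℝ) (u : E4) : ℝ :=
  fderiv ℝ f u (EuclideanSpace.single i 1)

/-- The inverse metric `g^{ij}`. -/
def ginv (G : E4 → Matrix (Fin 4) (Fin 4) ℝ) (u : E4) (i j : Fin 4) : ℝ := (G u)⁻¹ i j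

/-- The Christoffel symbol `Γ^k_{ij}` of the Levi-Civita connection. -/
def christoffel (G : E4 → Matrix (Fin 4) (Fin 4) ℝ) (k i j : Fin 4) (u : E4) : ℝ :=
  (1 / 2) * ∑ l, ginv G u k l *
    (pd i (fun v => G v j l) u + pd j (fun v => G v i l) u - pd l (fun v => G v i j) u)

/-- The `l`-th component of `R(∂_i, ∂_j) ∂_k`, where `R(X,Y) = [∇_X, ∇_Y] - ∇_{[X,Y]}`. -/
def curv (G : E4 → Matrix (Fin 4) (Fin 4) ℝ) (i j k l : Fin 4) (u : E4) : ℝ :=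
  pd i (christoffel G l j k) u - pd j (christoffel G l i k) u
    + ∑ m, (christoffel G m j k u * christoffel G l i m u
      - christoffel G m i k u * christoffel G l j m u)

/-- The Riemann tensor `R_{ijkl} = ⟨R(∂_i, ∂_j) ∂_k, ∂_l⟩`. -/
def riem (G : E4 → Matrix (Fin 4) (Fin 4) ℝ) (i j k l : Fin 4) (u : E4) : ℝ :=
  ∑ m, G u l m * curv G i j k m u

/-- The Ricci tensor `Ric_{jk}`, the trace of `X ↦ R(X, ∂_j) ∂_k`
(positive on the round sphere). -/
def ric (G : E4 → Matrix (Fin 4) (Fin 4) ℝ) (j k : Fin 4) (u : E4) : ℝ :=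
  ∑ i, curv G i j k i u

/-- The scalar curvature `R`. -/
def scal (G : E4 → Matrix (Fin 4) (Fin 4) ℝ) (u : E4) : ℝ :=
  ∑ j, ∑ k, ginv G u j k * ric G j k u

/-- `|Ric|²`. -/
def ricNormSq (G : E4 → Matrix (Fin 4) (Fin 4) ℝ) (u : E4) : ℝ :=
  ∑ i, ∑ j, ∑ a, ∑ b, ginv G u i a * ginv G u j b * ric G i j u * ric G a b u

/-- The Weyl tensor `W_{ijkl}` (dimension four). -/
def weyl (G : E4 → Matrix (Fin 4) (Fin 4) ℝ) (i j k l : Fin 4) (u : E4) : ℝ :=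
  riem G i j k l u
    - (1 / 2) * (ric G j k u * G u i l + ric G i l u * G u j k
        - ric G i k u * G u j l - ric G j l u * G u i k)
    + scal G u / 6 * (G u j k * G u i l - G u i k * G u j l)

/-- `|W|² = W_{ijkl} W^{ijkl}`. -/
def weylNormSq (G : E4 → Matrix (Fin 4) (Fin 4) ℝ) (u : E4) : ℝ :=
  ∑ i, ∑ j, ∑ k, ∑ l, ∑ a, ∑ b, ∑ c, ∑ d,
    ginv G u i a * ginv G u j b * ginv G u k c * ginv G u l d
      * weyl G i j k l u * weyl G a b c d u

/-- The Laplacian `Δf = g^{ij} (∂_i ∂_j f - Γ^k_{ij} ∂_k f)` in terms of the first partial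
derivatives `p i = ∂_i f` and the second ones `h i j = ∂_i ∂_j f` at the point `u`. -/
def lap (G : E4 → Matrix (Fin 4) (Fin 4) ℝ) (p : Fin 4 → ℝ) (h : Fin 4 → Fin 4 → ℝ)
    (u : E4) : ℝ :=
  ∑ i, ∑ j, ginv G u i j * (h i j - ∑ k, christoffel G k i j u * p k)

/-- `|∇f|² = g^{ij} ∂_i f ∂_j f`, where `p i = ∂_i f`. -/
def gradNormSq (G : E4 → Matrix (Fin 4) (Fin 4) ℝ) (p : Fin 4 → ℝ) (u : E4) : ℝ :=
  ∑ i, ∑ j, ginv G u i j * p i * p j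

/-- `Ric(∇f, ∇f)`, where `p i = ∂_i f`. -/
def ricGrad (G : E4 → Matrix (Fin 4) (Fin 4) ℝ) (p : Fin 4 → ℝ) (u : E4) : ℝ :=
  ∑ i, ∑ j, ∑ a, ∑ b, ginv G u i a * ginv G u j b * ric G i j u * p a * p b

/-- `ΔR`, the Laplacian of the scalar curvature. -/
def lapScal (G : E4 → Matrix (Fin 4) (Fin 4) ℝ) (u : E4) : ℝ :=
  lap G (fun i => pd i (scal G) u) (fun i j => pd i (pd j (scal G)) u) u

/-- The `Q`-curvature `Q = (1/12) (-ΔR + R² - 3 |Ric|²)`. -/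
def qCurv (G : E4 → Matrix (Fin 4) (Fin 4) ℝ) (u : E4) : ℝ :=
  (1 / 12) * (-lapScal G u + scal G u ^ 2 - 3 * ricNormSq G u)

/-- `h` is the weak `i`-th partial derivative of `f` on the open set `U ⊆ ℝ⁴`. -/
def HasWeakPartial (U : Set E4) (i : Fin 4) (f h : E4 → ℝ) : Prop :=
  ∀ χ : E4 → ℝ, ContDiff ℝ ∞ χ → HasCompactSupport χ → tsupport χ ⊆ U →
    ∫ u in U, f u * pd i χ u = -∫ u in U, h u * χ u

/-- `f ∈ L²_loc(U)`. -/
def MemL2Loc (U : Set E4) (f : E4 → ℝ) : Prop :=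
  ∀ K : Set E4, IsCompact K → K ⊆ U →
    MeasureTheory.MemLp f 2 (MeasureTheory.volume.restrict K)

/-! ### Closed Riemannian four-manifolds -/

section manifold

variable {M : Type*} [TopologicalSpace M] [ChartedSpace E4 M] [IsManifold (𝓡 4) ∞ M]

variable (M) in
/-- A smooth Riemannian metric on the four-manifold `M`. -/
abbrev Metric4 : Type _ :=
  Bundle.ContMDiffRiemannianMetric (𝓡 4) ∞ E4 (fun x : M => TangentSpace (𝓡 4) x)

/-- The coordinate vector field `∂_i` of the chart around `c`, at the point with
coordinates `u`. -/
def coordVec (c : M) (i : Fin 4) (u : E4) : TangentSpace (𝓡 4) ((chartAt E4 c).symm u) :=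
  mfderiv (𝓡 4) (𝓡 4) (chartAt E4 c).symm u
    (EuclideanSpace.single i (1 : ℝ) : E4)

/-- The matrix `g_ij = g(∂_i, ∂_j)` of the metric in the chart around `c`. -/
def metricMatrix (g : Metric4 M) (c : M) (u : E4) : Matrix (Fin 4) (Fin 4) ℝ :=
  Matrix.of fun i j => g.inner ((chartAt E4 c).symm u) (coordVec c i u) (coordVec c j u)

variable [T2Space M] [CompactSpace M]

variable (M) in
/-- A smooth partition of unity subordinate to the charts of `M`. -/
def chartPartition : SmoothPartitionOfUnity M (𝓡 4) M Set.univ :=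
  Classical.choose (SmoothPartitionOfUnity.exists_isSubordinate_chartAt_source (𝓡 4) M)

theorem chartPartition_isSubordinate :
    (chartPartition M).IsSubordinate fun x => (chartAt E4 x).source :=
  Classical.choose_spec (SmoothPartitionOfUnity.exists_isSubordinate_chartAt_source (𝓡 4) M)

/-- The integral `∫_M f dv` against the Riemannian volume `dv = √det(g_ij) du`, computed with a
partition of unity. The scalar function `f` on `M` is given through its expressions `f c` in the
charts around the points `c` of `M`. -/
def integral (g : Metric4 M) (f : M → E4 → ℝ) : ℝ :=
  ∑ᶠ c : M, ∫ u in (chartAt E4 c).target,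
    chartPartition M c ((chartAt E4 c).symm u) * f c u * Real.sqrt (metricMatrix g c u).det

/-- The mean value `(∫_M f dv) / Vol(M)`. -/
def mean (g : Metric4 M) (f : M → E4 → ℝ) : ℝ :=
  integral g f / integral g (fun _ _ => 1)

variable (M) in
/-- An element of the Sobolev space `W^{2,2}(M)` of the closed manifold `M`: a function `w` whose
expression in every chart lies in `L²_loc`, with weak partial derivatives of order one and two in
`L²_loc`. The weak derivatives, which `w` determines almost everywhere, are recorded. -/
structure W22 where
  /-- the function `w` -/
  toFun : M → ℝ
  /-- `d1 c i = ∂_i w` in the chart around `c` -/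
  d1 : M → Fin 4 → E4 → ℝ
  /-- `d2 c i j = ∂_i ∂_j w` in the chart around `c` -/
  d2 : M → Fin 4 → Fin 4 → E4 → ℝ
  memL2 : ∀ c, MemL2Loc (chartAt E4 c).target (fun u => toFun ((chartAt E4 c).symm u))
  memL2_d1 : ∀ c i, MemL2Loc (chartAt E4 c).target (d1 c i)
  memL2_d2 : ∀ c i j, MemL2Loc (chartAt E4 c).target (d2 c i j)
  weak_d1 : ∀ c i, HasWeakPartial (chartAt E4 c).target i
    (fun u => toFun ((chartAt E4 c).symm u)) (d1 c i)
  weak_d2 : ∀ c i j, HasWeakPartial (chartAt E4 c).target i (d1 c j) (d2 c i j)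

namespace W22

/-- The expression of `w` in the chart around `c`. -/
def loc (w : W22 M) (c : M) (u : E4) : ℝ := w.toFun ((chartAt E4 c).symm u)

/-- `Δw` in the chart around `c`. -/
def laplacian (g : Metric4 M) (w : W22 M) (c : M) (u : E4) : ℝ :=
  lap (metricMatrix g c) (fun i => w.d1 c i u) (fun i j => w.d2 c i j u) u

/-- `|∇w|²` in the chart around `c`. -/
def gradSq (g : Metric4 M) (w : W22 M) (c : M) (u : E4) : ℝ :=
  gradNormSq (metricMatrix g c) (fun i => w.d1 c i u) u

end W22

/-- The quadratic form `∫ w P w dv` of the Paneitz operator `P = Δ² + δ((2/3) R g - 2 Ric) ∘ ∇`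
on `W^{2,2}` (after integration by parts), that is
`∫ ((Δw)² + (2/3) R |∇w|² - 2 Ric(∇w, ∇w)) dv`. -/
def paneitzForm (g : Metric4 M) (w : W22 M) : ℝ :=
  integral g fun c u => w.laplacian g c u ^ 2
    + (2 / 3) * scal (metricMatrix g c) u * w.gradSq g c u
    - 2 * ricGrad (metricMatrix g c) (fun i => w.d1 c i u) u

/-- `∫ Q dv`. -/
def totalQ (g : Metric4 M) : ℝ := integral g fun c u => qCurv (metricMatrix g c) u

/-- `I[w] = 4 ∫ w |W|² dv - (∫ |W|² dv) log ⨍ e^{4w} dv`. -/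
def funcI (g : Metric4 M) (w : W22 M) : ℝ :=
  4 * integral g (fun c u => w.loc c u * weylNormSq (metricMatrix g c) u)
    - integral g (fun c u => weylNormSq (metricMatrix g c) u)
      * Real.log (mean g fun c u => Real.exp (4 * w.loc c u))

/-- `II[w] = ∫ w P w dv + 4 ∫ Q w dv - (∫ Q dv) log ⨍ e^{4w} dv`, whose critical points are the
conformal metrics of constant `Q`-curvature. -/
def funcII (g : Metric4 M) (w : W22 M) : ℝ :=
  paneitzForm g w + 4 * integral g (fun c u => qCurv (metricMatrix g c) u * w.loc c u)
    - totalQ g * Real.log (mean g fun c u => Real.exp (4 * w.loc c u))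

/-- The variant `∫ w P w dv - (∫ Q dv) log ⨍ e^{4(w - w̄)} dv` of `II`, with `w̄ = ⨍ w dv`; it
agrees with `II` when `Q` is constant. -/
def funcII' (g : Metric4 M) (w : W22 M) : ℝ :=
  paneitzForm g w
    - totalQ g * Real.log (mean g fun c u => Real.exp (4 * (w.loc c u - mean g w.loc)))

/-- `III[w] = 12 ∫ (Δw + |∇w|²)² dv - 4 ∫ (w ΔR + R |∇w|²) dv`. -/
def funcIII (g : Metric4 M) (w : W22 M) : ℝ :=
  12 * integral g (fun c u => (w.laplacian g c u + w.gradSq g c u) ^ 2)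
    - 4 * integral g (fun c u => w.loc c u * lapScal (metricMatrix g c) u
      + scal (metricMatrix g c) u * w.gradSq g c u)

/-- The functional `γ₁ I + γ₂ II + γ₃ III`. -/
def detFunctional (γ₁ γ₂ γ₃ : ℝ) (g : Metric4 M) (w : W22 M) : ℝ :=
  γ₁ * funcI g w + γ₂ * funcII g w + γ₃ * funcIII g w

/-- The functional `γ₁ I + γ₂ II' + γ₃ III`. -/
def detFunctional' (γ₁ γ₂ γ₃ : ℝ) (g : Metric4 M) (w : W22 M) : ℝ :=
  γ₁ * funcI g w + γ₂ * funcII' g w + γ₃ * funcIII g w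

/-- `F_P`, the functional of the log-determinant of the Paneitz operator. -/
def FP (g : Metric4 M) (w : W22 M) : ℝ := detFunctional (-1 / 4) (-14) (8 / 3) g w

/-- `F_τ`, the functional of Cheeger's half-torsion. -/
def Fτ (g : Metric4 M) (w : W22 M) : ℝ := detFunctional (-13) (-248) (116 / 3) g w

/-- `F_P` with `II'` in place of `II`. -/
def FP' (g : Metric4 M) (w : W22 M) : ℝ := detFunctional' (-1 / 4) (-14) (8 / 3) g w

/-- `F_τ` with `II'` in place of `II`. -/
def Fτ' (g : Metric4 M) (w : W22 M) : ℝ := detFunctional' (-13) (-248) (116 / 3) g w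

end manifold

end

end ConformalFour

/-! Both determinant functionals satisfy γ₃ > 0 and γ₂ + 3γ₃ < 0 (the sum is -6 for F_P and -132 for
F_τ), and nothing else about the coefficients matters. On smooth `w` each functional, with II or
with II', is a `smoothFunctional`: the integral of an expression in Δw, |∇w|², Ric(∇w,∇w), a linear
term ∫ Z w, and Λ log ⨍ e^{4w}. The continuous Z and the number Λ are of lower order in both
arguments below, so no sign of ∫ Q is needed, and γ₁ is free.

Unbounded above (`exists_le_smoothFunctional`): for w = tρ with ρ nonconstant, the term 12 γ₃ t⁴ ∫
|∇ρ|⁴ beats everything else, which is O(t³).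

Unbounded below (`exists_smoothFunctional_le`): let ρ ≥ 0 be smooth, zero only at a point p, and
equal to the squared distance to p to leading order, so that Δρ → 8 at p and |∇ρ|² = 4ρ + o(ρ). With
s = ε² + ρ and w = -(1/2) log s one has Δw ≈ -2/s and |∇w|² ≈ 1/s where ε² ≪ ρ ≪ 1, hence γ₂ (Δw)² +
12 γ₃ (Δw + |∇w|²)² ≈ 4(γ₂ + 3γ₃)/s². The integral J of 1/s² diverges as ε → 0, because |x|⁻⁴ is not
integrable near 0 in ℝ⁴. In the core ρ ≲ ε² the approximation fails, but the error there is at most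
a multiple of ε²/s³, whose integral is bounded uniformly in ε by scaling. The remaining terms are
O(1 + 1/s) and are absorbed by 1/s². Finally e^{4w} = 1/s², so the logarithmic term is Λ log(J/Vol)
= o(J). Giving up part of the factor 4, the functional is at most 2(γ₂ + 3γ₃) J + Λ log(J/Vol) +
const, which tends to -∞.

All quantities are computed chart by chart. Coordinate invariance of curvature is never used:
curvature terms are only bounded on the compact supports of the partition of unity. Only the
behaviour of ρ near p is precise, and it is established in every chart around p. -/

namespace ConformalFour

open scoped Topology
open MeasureTheory

/-! ### Smoothness of the coordinate expressions, chain rules, weak derivatives. -/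

section Euclidean

variable {U : Set E4} {G : E4 → Matrix (Fin 4) (Fin 4) ℝ}

theorem contDiffOn_pd (hU : IsOpen U) {f : E4 → ℝ} (hf : ContDiffOn ℝ ∞ f U) (i : Fin 4) :
    ContDiffOn ℝ ∞ (pd i f) U :=
  (hf.fderiv_of_isOpen hU (by simp)).clm_apply contDiffOn_const

theorem contDiffOn_det {n : ℕ} {A : E4 → Matrix (Fin n) (Fin n) ℝ}
    (hA : ∀ i j, ContDiffOn ℝ ∞ (fun u => A u i j) U) :
    ContDiffOn ℝ ∞ (fun u => (A u).det) U := by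
  simp only [Matrix.det_apply']
  exact ContDiffOn.sum fun σ _ => contDiffOn_const.mul (contDiffOn_prod fun i _ => hA _ _)

/-- Cramer's rule: an entry of the inverse is a quotient of two determinants, both polynomial in the
entries of `G`. -/
theorem contDiffOn_ginv (hG : ∀ i j, ContDiffOn ℝ ∞ (fun u => G u i j) U)
    (hdet : ∀ u ∈ U, (G u).det ≠ 0) (i j : Fin 4) :
    ContDiffOn ℝ ∞ (fun u => ginv G u i j) U := by
  have h : ∀ u, ginv G u i j = (G u).det⁻¹ * ((G u).updateRow j (Pi.single i 1)).det := by
    intro u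
    simp [ginv, Matrix.inv_def, Matrix.adjugate_apply]
  simp only [h]
  refine ((contDiffOn_det hG).inv hdet).mul (contDiffOn_det fun a b => ?_)
  by_cases ha : a = j
  · subst ha
    simpa using contDiffOn_const
  · simpa [Matrix.updateRow_ne ha] using hG a b

/-- A smooth field of positive definite matrices on an open set. -/
structure IsSmoothMetric (U : Set E4) (G : E4 → Matrix (Fin 4) (Fin 4) ℝ) : Prop where
  isOpen : IsOpen U
  smooth : ∀ i j, ContDiffOn ℝ ∞ (fun u => G u i j) U
  posDef : ∀ u ∈ U, (G u).PosDef

namespace IsSmoothMetric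

theorem ginv (h : IsSmoothMetric U G) (i j : Fin 4) :
    ContDiffOn ℝ ∞ (fun u => ginv G u i j) U :=
  contDiffOn_ginv h.smooth (fun u hu => (h.posDef u hu).det_pos.ne') i j

theorem christoffel (h : IsSmoothMetric U G) (k i j : Fin 4) :
    ContDiffOn ℝ ∞ (christoffel G k i j) U := by
  refine contDiffOn_const.mul (ContDiffOn.sum fun l _ => (h.ginv k l).mul ?_)
  exact ((contDiffOn_pd h.isOpen (h.smooth j l) i).add
    (contDiffOn_pd h.isOpen (h.smooth i l) j)).sub (contDiffOn_pd h.isOpen (h.smooth i j) l)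

theorem curv (h : IsSmoothMetric U G) (i j k l : Fin 4) :
    ContDiffOn ℝ ∞ (curv G i j k l) U := by
  refine ((contDiffOn_pd h.isOpen (h.christoffel l j k) i).sub
    (contDiffOn_pd h.isOpen (h.christoffel l i k) j)).add (ContDiffOn.sum fun m _ => ?_)
  exact ((h.christoffel m j k).mul (h.christoffel l i m)).sub
    ((h.christoffel m i k).mul (h.christoffel l j m))

theorem riem (h : IsSmoothMetric U G) (i j k l : Fin 4) :
    ContDiffOn ℝ ∞ (riem G i j k l) U :=
  ContDiffOn.sum fun m _ => (h.smooth l m).mul (h.curv i j k m)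

theorem ric (h : IsSmoothMetric U G) (j k : Fin 4) : ContDiffOn ℝ ∞ (ric G j k) U :=
  ContDiffOn.sum fun i _ => h.curv i j k i

theorem scal (h : IsSmoothMetric U G) : ContDiffOn ℝ ∞ (scal G) U :=
  ContDiffOn.sum fun j _ => ContDiffOn.sum fun k _ => (h.ginv j k).mul (h.ric j k)

theorem ricNormSq (h : IsSmoothMetric U G) : ContDiffOn ℝ ∞ (ricNormSq G) U :=
  ContDiffOn.sum fun i _ => ContDiffOn.sum fun j _ => ContDiffOn.sum fun a _ =>
    ContDiffOn.sum fun b _ => (((h.ginv i a).mul (h.ginv j b)).mul (h.ric i j)).mul (h.ric a b)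

theorem weyl (h : IsSmoothMetric U G) (i j k l : Fin 4) :
    ContDiffOn ℝ ∞ (weyl G i j k l) U := by
  refine ((h.riem i j k l).sub (contDiffOn_const.mul ?_)).add
    ((h.scal.div_const 6).mul (((h.smooth j k).mul (h.smooth i l)).sub
      ((h.smooth i k).mul (h.smooth j l))))
  exact ((((h.ric j k).mul (h.smooth i l)).add ((h.ric i l).mul (h.smooth j k))).sub
    ((h.ric i k).mul (h.smooth j l))).sub ((h.ric j l).mul (h.smooth i k))

theorem weylNormSq (h : IsSmoothMetric U G) : ContDiffOn ℝ ∞ (weylNormSq G) U :=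
  ContDiffOn.sum fun i _ => ContDiffOn.sum fun j _ => ContDiffOn.sum fun k _ =>
    ContDiffOn.sum fun l _ => ContDiffOn.sum fun a _ => ContDiffOn.sum fun b _ =>
    ContDiffOn.sum fun c _ => ContDiffOn.sum fun d _ =>
    (((((h.ginv i a).mul (h.ginv j b)).mul (h.ginv k c)).mul (h.ginv l d)).mul
      (h.weyl i j k l)).mul (h.weyl a b c d)

theorem lap (h : IsSmoothMetric U G) {p : Fin 4 → E4 → ℝ} {q : Fin 4 → Fin 4 → E4 → ℝ}
    (hp : ∀ i, ContDiffOn ℝ ∞ (p i) U) (hq : ∀ i j, ContDiffOn ℝ ∞ (q i j) U) :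
    ContDiffOn ℝ ∞ (fun u => lap G (fun i => p i u) (fun i j => q i j u) u) U :=
  ContDiffOn.sum fun i _ => ContDiffOn.sum fun j _ => (h.ginv i j).mul
    ((hq i j).sub (ContDiffOn.sum fun k _ => (h.christoffel k i j).mul (hp k)))

theorem gradNormSq (h : IsSmoothMetric U G) {p : Fin 4 → E4 → ℝ}
    (hp : ∀ i, ContDiffOn ℝ ∞ (p i) U) :
    ContDiffOn ℝ ∞ (fun u => gradNormSq G (fun i => p i u) u) U :=
  ContDiffOn.sum fun i _ => ContDiffOn.sum fun j _ => ((h.ginv i j).mul (hp i)).mul (hp j)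

theorem ricGrad (h : IsSmoothMetric U G) {p : Fin 4 → E4 → ℝ}
    (hp : ∀ i, ContDiffOn ℝ ∞ (p i) U) :
    ContDiffOn ℝ ∞ (fun u => ricGrad G (fun i => p i u) u) U :=
  ContDiffOn.sum fun i _ => ContDiffOn.sum fun j _ => ContDiffOn.sum fun a _ =>
    ContDiffOn.sum fun b _ =>
      ((((h.ginv i a).mul (h.ginv j b)).mul (h.ric i j)).mul (hp a)).mul (hp b)

theorem lapScal (h : IsSmoothMetric U G) : ContDiffOn ℝ ∞ (lapScal G) U :=
  h.lap (fun i => contDiffOn_pd h.isOpen h.scal i)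
    (fun i j => contDiffOn_pd h.isOpen (contDiffOn_pd h.isOpen h.scal j) i)

theorem qCurv (h : IsSmoothMetric U G) : ContDiffOn ℝ ∞ (qCurv G) U :=
  contDiffOn_const.mul ((h.lapScal.neg.add (h.scal.pow 2)).sub
    (contDiffOn_const.mul h.ricNormSq))

end IsSmoothMetric

/-- Chain rule for the first partial derivatives. -/
theorem pd_comp {f : E4 → ℝ} {h : ℝ → ℝ} {u : E4} (hf : DifferentiableAt ℝ f u)
    (hh : DifferentiableAt ℝ h (f u)) (i : Fin 4) :
    pd i (fun v => h (f v)) u = deriv h (f u) * pd i f u := by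
  have := (hh.hasDerivAt.comp_hasFDerivAt u hf.hasFDerivAt).fderiv
  simp only [pd]
  change (fderiv ℝ (h ∘ f) u) _ = _
  rw [this]; simp

theorem pd_mul {f h : E4 → ℝ} {u : E4} (hf : DifferentiableAt ℝ f u)
    (hh : DifferentiableAt ℝ h u) (i : Fin 4) :
    pd i (fun v => f v * h v) u = f u * pd i h u + h u * pd i f u := by
  simp only [pd]
  rw [fderiv_fun_mul hf hh]; simp

theorem pd_congr {f h : E4 → ℝ} {u : E4} (hfh : f =ᶠ[nhds u] h) (i : Fin 4) :
    pd i f u = pd i h u := by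
  simp only [pd, hfh.fderiv_eq]

theorem pd_eventuallyEq {f h : E4 → ℝ} {u : E4} (hfh : f =ᶠ[nhds u] h) (i : Fin 4) :
    pd i f =ᶠ[nhds u] pd i h := by
  filter_upwards [hfh.eventuallyEq_nhds] with v hv using pd_congr hv i

theorem pd_sum {ι : Type*} (s : Finset ι) {f : ι → E4 → ℝ} {u : E4}
    (hf : ∀ k ∈ s, DifferentiableAt ℝ (f k) u) (i : Fin 4) :
    pd i (fun v => ∑ k ∈ s, f k v) u = ∑ k ∈ s, pd i (f k) u := by
  simp only [pd]
  rw [fderiv_fun_sum hf]; simp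

/-- Chain rule for the second partial derivatives. -/
theorem pd_pd_comp (hU : IsOpen U) {f : E4 → ℝ} (hf : ContDiffOn ℝ ∞ f U) {h : ℝ → ℝ}
    {I : Set ℝ} (hI : IsOpen I) (hh : ContDiffOn ℝ ∞ h I) (hfI : ∀ u ∈ U, f u ∈ I)
    {u : E4} (hu : u ∈ U) (i j : Fin 4) :
    pd i (pd j fun v => h (f v)) u =
      deriv h (f u) * pd i (pd j f) u + deriv (deriv h) (f u) * (pd i f u * pd j f u) := by
  have hd : ∀ v ∈ U, DifferentiableAt ℝ f v := fun v hv =>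
    (hf.contDiffAt (hU.mem_nhds hv)).differentiableAt (by simp)
  have hhd : ∀ x ∈ I, DifferentiableAt ℝ h x := fun x hx =>
    (hh.contDiffAt (hI.mem_nhds hx)).differentiableAt (by simp)
  have hh' : ContDiffOn ℝ ∞ (deriv h) I := hh.deriv_of_isOpen hI (by simp)
  have hhd' : ∀ x ∈ I, DifferentiableAt ℝ (deriv h) x := fun x hx =>
    (hh'.contDiffAt (hI.mem_nhds hx)).differentiableAt (by simp)
  have e : (pd j fun v => h (f v)) =ᶠ[nhds u] fun v => deriv h (f v) * pd j f v := by
    filter_upwards [hU.mem_nhds hu] with v hv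
    exact pd_comp (hd v hv) (hhd _ (hfI v hv)) j
  rw [pd_congr e, pd_mul, pd_comp (hd u hu) (hhd' _ (hfI u hu))]
  · ring
  · exact (hhd' _ (hfI u hu)).comp u (hd u hu)
  · exact ((contDiffOn_pd hU hf j).contDiffAt (hU.mem_nhds hu)).differentiableAt (by simp)

/-- With a = h'(f) and b = h''(f) this is Δ(h ∘ f) = h'(f) Δf + h''(f) |∇f|². -/
theorem lap_comp (p : Fin 4 → ℝ) (q : Fin 4 → Fin 4 → ℝ) (a b : ℝ) (u : E4) :
    lap G (fun i => a * p i) (fun i j => a * q i j + b * (p i * p j)) u =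
      a * lap G p q u + b * gradNormSq G p u := by
  simp only [lap, gradNormSq, Finset.mul_sum, ← Finset.sum_add_distrib]
  refine Finset.sum_congr rfl fun i _ => Finset.sum_congr rfl fun j _ => ?_
  have : ∑ k, ConformalFour.christoffel G k i j u * (a * p k) =
      a * ∑ k, ConformalFour.christoffel G k i j u * p k := by
    rw [Finset.mul_sum]; exact Finset.sum_congr rfl fun k _ => by ring
  rw [this]; ring

theorem gradNormSq_smul (p : Fin 4 → ℝ) (a : ℝ) (u : E4) :
    gradNormSq G (fun i => a * p i) u = a ^ 2 * gradNormSq G p u := by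
  simp only [gradNormSq, Finset.mul_sum]
  exact Finset.sum_congr rfl fun i _ => Finset.sum_congr rfl fun j _ => by ring

theorem ricGrad_smul (p : Fin 4 → ℝ) (a : ℝ) (u : E4) :
    ricGrad G (fun i => a * p i) u = a ^ 2 * ricGrad G p u := by
  simp only [ricGrad, Finset.mul_sum]
  exact Finset.sum_congr rfl fun i _ => Finset.sum_congr rfl fun j _ =>
    Finset.sum_congr rfl fun _ _ => Finset.sum_congr rfl fun _ _ => by ring

theorem gradNormSq_nonneg {u : E4} (hG : (G u).PosDef) (p : Fin 4 → ℝ) :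
    0 ≤ gradNormSq G p u := by
  have := hG.inv.posSemidef.dotProduct_mulVec_nonneg p
  simpa [gradNormSq, ginv, dotProduct, Matrix.mulVec, Finset.mul_sum, mul_assoc,
    mul_comm, mul_left_comm] using this

/-- A continuously differentiable function is a weak primitive of its partial derivatives. -/
theorem hasWeakPartial_pd (hU : IsOpen U) {f : E4 → ℝ} (hf : ContDiffOn ℝ ∞ f U) (i : Fin 4) :
    HasWeakPartial U i f (pd i f) := by
  intro χ hχ hc hsub
  have hsm : ContDiff ℝ ∞ fun v => f v * χ v := by
    rw [contDiff_iff_contDiffAt]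
    intro v
    by_cases hv : v ∈ tsupport χ
    · exact (hf.contDiffAt (hU.mem_nhds (hsub hv))).mul hχ.contDiffAt
    · have : (fun v => f v * χ v) =ᶠ[nhds v] fun _ => 0 := by
        filter_upwards [(isClosed_tsupport χ).isOpen_compl.mem_nhds hv] with w hw
        simp [image_eq_zero_of_notMem_tsupport hw]
      exact contDiffAt_const.congr_of_eventuallyEq this
  have hcs : HasCompactSupport fun v => f v * χ v := hc.mul_left
  -- Integration by parts against the constant 1: a derivative of a compactly supported function has
  -- integral zero.
  have h0 : ∫ v, pd i (fun v => f v * χ v) v = 0 := by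
    have := integral_mul_fderiv_eq_neg_fderiv_mul_of_integrable
      (μ := MeasureTheory.volume) (f := fun _ : E4 => (1 : ℝ)) (g := fun v => f v * χ v)
      (v := EuclideanSpace.single i 1) (by simp) ?_ ?_ (by fun_prop)
      (fun x _ => hsm.differentiable (by simp) x)
    · simpa [pd] using this
    · simpa using ((hsm.continuous_fderiv (by simp)).clm_apply
        continuous_const).integrable_of_hasCompactSupport
          (hcs.fderiv_apply (𝕜 := ℝ) (v := EuclideanSpace.single i (1 : ℝ)))
    · simpa using hsm.continuous.integrable_of_hasCompactSupport hcs
  have hpdχ : ∀ v ∉ tsupport χ, pd i χ v = 0 := by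
    intro v hv
    have := image_eq_zero_of_notMem_tsupport fun h => hv (tsupport_fderiv_subset ℝ (f := χ) h)
    simp [pd, this]
  have e : ∀ v ∈ U, pd i (fun v => f v * χ v) v = f v * pd i χ v + pd i f v * χ v := by
    intro v hv
    rw [pd_mul ((hf.contDiffAt (hU.mem_nhds hv)).differentiableAt (by simp))
      (hχ.contDiffAt.differentiableAt (by simp))]
    ring
  have hcont : ∀ {a b : E4 → ℝ}, ContinuousOn a U → Continuous b →
      (∀ v ∉ tsupport χ, b v = 0) → MeasureTheory.IntegrableOn (fun v => a v * b v) U := by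
    intro a b ha hb hb0
    refine MeasureTheory.IntegrableOn.of_forall_sdiff_eq_zero (s := tsupport χ)
      (((ha.mono hsub).mul hb.continuousOn).integrableOn_compact hc) hU.measurableSet ?_
    intro v hv
    simp [hb0 v hv.2]
  have i1 := hcont hf.continuousOn ((hχ.continuous_fderiv (by simp)).clm_apply
    (continuous_const (y := EuclideanSpace.single i (1 : ℝ)))) hpdχ
  have i2 := hcont (contDiffOn_pd hU hf i).continuousOn hχ.continuous
    fun v hv => image_eq_zero_of_notMem_tsupport hv
  rw [eq_neg_iff_add_eq_zero]
  change (∫ v in U, f v * (fderiv ℝ χ v) (EuclideanSpace.single i (1 : ℝ))) + _ = 0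
  have hz : ∀ v ∉ U, pd i (fun v => f v * χ v) v = 0 := by
    intro v hv
    have hv' : v ∉ tsupport fun v => f v * χ v := fun h => hv (hsub (tsupport_mul_subset_right h))
    have := image_eq_zero_of_notMem_tsupport fun h => hv' (tsupport_fderiv_subset ℝ h)
    simp only [pd, this, zero_apply]
  rw [← MeasureTheory.integral_add i1 i2, ← h0,
    ← MeasureTheory.setIntegral_eq_integral_of_forall_compl_eq_zero hz]
  exact MeasureTheory.setIntegral_congr_fun hU.measurableSet fun v hv => (e v hv).symm

theorem memL2Loc_of_continuousOn {f : E4 → ℝ} (hf : ContinuousOn f U) : MemL2Loc U f := by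
  intro K hK hKU
  obtain ⟨C, hC⟩ := hK.exists_bound_of_continuousOn (hf.mono hKU)
  have : MeasureTheory.IsFiniteMeasure (MeasureTheory.volume.restrict K) :=
    ⟨by simpa using hK.measure_lt_top⟩
  refine MeasureTheory.MemLp.of_bound
    ((hf.mono hKU).aestronglyMeasurable hK.measurableSet) C ?_
  exact (MeasureTheory.ae_restrict_iff' hK.measurableSet).2 (Filter.Eventually.of_forall hC)

end Euclidean

/-! ### Squared distances to leading order in a coordinate domain. -/

section Local

variable {U V : Set E4} {G : E4 → Matrix (Fin 4) (Fin 4) ℝ}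

theorem fderiv_eq_sum_pd (f : E4 → ℝ) (u v : E4) : fderiv ℝ f u v = ∑ i, v i * pd i f u := by
  have hv : v = ∑ i, v i • EuclideanSpace.single i (1 : ℝ) := by
    ext j; simp [Finset.sum_apply, Pi.single_apply]
  conv_lhs => rw [hv]
  simp [pd]

theorem pd_sum_sq (hV : IsOpen V) {f : Fin 4 → E4 → ℝ} (hf : ∀ k, ContDiffOn ℝ ∞ (f k) V)
    {u : E4} (hu : u ∈ V) (i : Fin 4) :
    pd i (fun v => ∑ k, f k v ^ 2) u = ∑ k, 2 * (f k u * pd i (f k) u) := by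
  have hd : ∀ k, DifferentiableAt ℝ (f k) u := fun k =>
    ((hf k).contDiffAt (hV.mem_nhds hu)).differentiableAt (by simp)
  rw [pd_sum _ fun k _ => (hd k).fun_pow 2]
  refine Finset.sum_congr rfl fun k _ => ?_
  simp only [sq]
  rw [pd_mul (hd k) (hd k)]; ring

theorem pd_pd_sum_sq (hV : IsOpen V) {f : Fin 4 → E4 → ℝ} (hf : ∀ k, ContDiffOn ℝ ∞ (f k) V)
    {u : E4} (hu : u ∈ V) (i j : Fin 4) :
    pd i (pd j fun v => ∑ k, f k v ^ 2) u =
      ∑ k, 2 * (f k u * pd i (pd j (f k)) u + pd j (f k) u * pd i (f k) u) := by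
  have hd : ∀ k, DifferentiableAt ℝ (f k) u := fun k =>
    ((hf k).contDiffAt (hV.mem_nhds hu)).differentiableAt (by simp)
  have hd' : ∀ k, DifferentiableAt ℝ (pd j (f k)) u := fun k =>
    ((contDiffOn_pd hV (hf k) j).contDiffAt (hV.mem_nhds hu)).differentiableAt (by simp)
  have e : (pd j fun v => ∑ k, f k v ^ 2) =ᶠ[nhds u] fun v => ∑ k, 2 * (f k v * pd j (f k) v) := by
    filter_upwards [hV.mem_nhds hu] with v hv using pd_sum_sq hV hf hv j
  rw [pd_congr e, pd_sum _ fun k _ => ((hd k).fun_mul (hd' k)).const_mul 2]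
  refine Finset.sum_congr rfl fun k _ => ?_
  rw [pd_mul (by fun_prop) ((hd k).fun_mul (hd' k)), pd_mul (hd k) (hd' k)]
  simp [pd]

/-- `f` is a system of four functions vanishing at `u₀`, whose differentials form an orthonormal
coframe there, and `r` is the sum of their squares. -/
structure IsSquareDistance (U : Set E4) (G : E4 → Matrix (Fin 4) (Fin 4) ℝ) (u₀ : E4)
    (f : Fin 4 → E4 → ℝ) (r : E4 → ℝ) : Prop where
  mem : u₀ ∈ U
  isOpen : IsOpen U
  smooth : ∀ k, ContDiffOn ℝ ∞ (f k) U
  zero : ∀ k, f k u₀ = 0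
  coframe : ∀ i j, G u₀ i j = ∑ k, pd i (f k) u₀ * pd j (f k) u₀
  eq : ∀ u ∈ U, r u = ∑ k, f k u ^ 2

namespace IsSquareDistance

variable {u₀ : E4} {f : Fin 4 → E4 → ℝ} {r : E4 → ℝ}

theorem eventuallyEq (h : IsSquareDistance U G u₀ f r) {u : E4} (hu : u ∈ U) :
    r =ᶠ[nhds u] fun u => ∑ k, f k u ^ 2 := by
  filter_upwards [h.isOpen.mem_nhds hu] with v hv using h.eq v hv

theorem pd_eq (h : IsSquareDistance U G u₀ f r) {u : E4} (hu : u ∈ U) (i : Fin 4) :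
    pd i r u = 2 * ∑ k, f k u * pd i (f k) u := by
  rw [pd_congr (h.eventuallyEq hu), pd_sum_sq h.isOpen h.smooth hu, Finset.mul_sum]

theorem matrix_eq (h : IsSquareDistance U G u₀ f r) :
    G u₀ = (Matrix.of fun k i => pd i (f k) u₀).transpose * Matrix.of fun k i => pd i (f k) u₀ := by
  ext i j
  simp [h.coframe, Matrix.mul_apply]

/-- The matrix D of the differentials satisfies G = DᵀD at `u₀`, hence D G⁻¹ Dᵀ = 1: the coframe is
orthonormal for the inverse metric. -/
theorem pairing (h : IsSquareDistance U G u₀ f r) (hG : (G u₀).PosDef) (k l : Fin 4) :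
    ∑ i, ∑ j, ginv G u₀ i j * pd i (f k) u₀ * pd j (f l) u₀ = if k = l then 1 else 0 := by
  set D : Matrix (Fin 4) (Fin 4) ℝ := Matrix.of fun k i => pd i (f k) u₀ with hD
  have hdet : IsUnit D.det := by
    have := hG.det_pos
    rw [h.matrix_eq, Matrix.det_mul, Matrix.det_transpose] at this
    exact isUnit_iff_ne_zero.2 fun h0 => by simp [← hD, h0] at this
  have e : D * (G u₀)⁻¹ * D.transpose = 1 := by
    rw [h.matrix_eq, ← hD, Matrix.mul_inv_rev, ← Matrix.mul_assoc, Matrix.mul_nonsing_inv _ hdet,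
      Matrix.one_mul, Matrix.nonsing_inv_mul _ (by simpa using hdet)]
  have := congrFun (congrFun e k) l
  rw [Matrix.one_apply] at this
  rw [← this, Matrix.mul_apply, Finset.sum_comm]
  refine Finset.sum_congr rfl fun j _ => ?_
  rw [Matrix.mul_apply, Finset.sum_mul]
  refine Finset.sum_congr rfl fun i _ => ?_
  simp only [hD, ginv, Matrix.of_apply, Matrix.transpose_apply]; ring

/-- Since every `f k` vanishes at `u₀`, so does dr, and the Christoffel terms drop out without
normal coordinates. The second derivatives of `r` at `u₀` are 2G, with trace 2 · 4. -/
theorem lap_eq (h : IsSquareDistance U G u₀ f r) (hG : (G u₀).PosDef) :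
    lap G (fun i => pd i r u₀) (fun i j => pd i (pd j r) u₀) u₀ = 8 := by
  have h1 : ∀ i, pd i r u₀ = 0 := fun i => by rw [h.pd_eq h.mem]; simp [h.zero]
  have h2 : ∀ i j, pd i (pd j r) u₀ = 2 * G u₀ i j := fun i j => by
    rw [pd_congr (pd_eventuallyEq (h.eventuallyEq h.mem) j),
      pd_pd_sum_sq h.isOpen h.smooth h.mem, h.coframe, Finset.mul_sum]
    refine Finset.sum_congr rfl fun k _ => ?_
    rw [h.zero]; ring
  have hT : ∀ i j, G u₀ i j = G u₀ j i := fun i j => by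
    simpa using congrFun (congrFun hG.isHermitian i) j |>.symm
  have h3 : ∀ i, ∑ j, ginv G u₀ i j * G u₀ j i = 1 := fun i => by
    have := congrFun (congrFun (Matrix.nonsing_inv_mul (G u₀) hG.det_pos.ne'.isUnit) i) i
    rw [Matrix.mul_apply] at this
    simpa [ginv] using this
  simp only [lap, h1, h2, mul_zero, Finset.sum_const_zero, sub_zero]
  calc _ = ∑ i, 2 * ∑ j, ginv G u₀ i j * G u₀ j i := by
        refine Finset.sum_congr rfl fun i _ => ?_
        rw [Finset.mul_sum]
        exact Finset.sum_congr rfl fun j _ => by rw [hT i j]; ring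
    _ = 8 := by simp [h3]; norm_num

theorem sum_abs_mul_le (x : Fin 4 → ℝ) : ∑ k, ∑ l, |x k| * |x l| ≤ 4 * ∑ k, x k ^ 2 := by
  rw [← Finset.sum_mul_sum, ← sq]
  simpa using sq_sum_le_card_mul_sum_sq (s := Finset.univ) (f := fun k => |x k|)

/-- Here |∇r|² = 4 Σ m_kl f_k f_l, where m is the Gram matrix of the differentials. It is continuous
and equals the identity at `u₀`, so the error is small relative to Σ f_k² = r. -/
theorem gradNormSq_eventually (h : IsSquareDistance U G u₀ f r) (hG : IsSmoothMetric U G)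
    {η : ℝ} (hη : 0 < η) :
    ∀ᶠ u in nhds u₀, |gradNormSq G (fun i => pd i r u) u - 4 * r u| ≤ η * r u := by
  set m : Fin 4 → Fin 4 → E4 → ℝ := fun k l u =>
    ∑ i, ∑ j, ginv G u i j * pd i (f k) u * pd j (f l) u with hm
  have hU := h.isOpen.mem_nhds h.mem
  have hcont : ∀ k l, ContinuousAt (m k l) u₀ := fun k l => by
    have : ContDiffOn ℝ ∞ (m k l) U := ContDiffOn.sum fun i _ => ContDiffOn.sum fun j _ =>
      ((hG.ginv i j).mul (contDiffOn_pd h.isOpen (h.smooth k) i)).mul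
        (contDiffOn_pd h.isOpen (h.smooth l) j)
    exact this.continuousOn.continuousAt hU
  -- The tolerance is η/16 because the error is multiplied by 4 from |∇r|² and by 4 from
  -- `sum_abs_mul_le`.
  have hev : ∀ k l, ∀ᶠ u in nhds u₀, |m k l u - if k = l then 1 else 0| < η / 16 := fun k l => by
    have := hcont k l
    rw [ContinuousAt, hm, ← h.pairing (hG.posDef _ h.mem) k l, Metric.tendsto_nhds] at *
    simpa [Real.dist_eq] using this (η / 16) (by positivity)
  filter_upwards [hU, Filter.eventually_all.2 fun k => Filter.eventually_all.2 (hev k)]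
    with u hu hk
  have e1 : gradNormSq G (fun i => pd i r u) u = 4 * ∑ k, ∑ l, m k l u * (f k u * f l u) := by
    simp only [gradNormSq, h.pd_eq hu, hm, Finset.mul_sum, Finset.sum_mul]
    simp only [Fin.sum_univ_four]
    ring
  have e2 : r u = ∑ k, ∑ l, (if k = l then 1 else 0) * (f k u * f l u) := by
    rw [h.eq u hu]
    simp [sq]
  have e3 : gradNormSq G (fun i => pd i r u) u - 4 * r u =
      4 * ∑ k, ∑ l, (m k l u - if k = l then 1 else 0) * (f k u * f l u) := by
    rw [e1, e2, ← mul_sub]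
    simp only [← Finset.sum_sub_distrib, sub_mul]
  rw [e3, abs_mul, abs_of_pos (by norm_num : (0 : ℝ) < 4)]
  calc 4 * |∑ k, ∑ l, (m k l u - if k = l then 1 else 0) * (f k u * f l u)|
      ≤ 4 * ∑ k, ∑ l, η / 16 * (|f k u| * |f l u|) := by
        gcongr
        refine (Finset.abs_sum_le_sum_abs _ _).trans (Finset.sum_le_sum fun k _ => ?_)
        refine (Finset.abs_sum_le_sum_abs _ _).trans (Finset.sum_le_sum fun l _ => ?_)
        rw [abs_mul, abs_mul]
        gcongr
        exact (hk k l).le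
    _ = η / 4 * ∑ k, ∑ l, |f k u| * |f l u| := by
        simp only [Finset.mul_sum]
        exact Finset.sum_congr rfl fun _ _ => Finset.sum_congr rfl fun _ _ => by ring
    _ ≤ η / 4 * (4 * ∑ k, f k u ^ 2) := by gcongr; exact sum_abs_mul_le _
    _ = η * r u := by rw [h.eq u hu]; ring

/-- Cauchy–Schwarz applied to ∂_i r = 2 Σ f_k ∂_i f_k. -/
theorem sum_pd_sq_eventually (h : IsSquareDistance U G u₀ f r) :
    ∃ C, ∀ᶠ u in nhds u₀, ∑ i, pd i r u ^ 2 ≤ C * r u := by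
  set m : E4 → ℝ := fun u => ∑ i, ∑ k, pd i (f k) u ^ 2 with hm
  have hU := h.isOpen.mem_nhds h.mem
  have hcont : ContinuousAt m u₀ := by
    have : ContDiffOn ℝ ∞ m U := ContDiffOn.sum fun i _ => ContDiffOn.sum fun k _ =>
      (contDiffOn_pd h.isOpen (h.smooth k) i).pow 2
    exact this.continuousOn.continuousAt hU
  refine ⟨4 * (m u₀ + 1), ?_⟩
  filter_upwards [hU, hcont.eventually_lt (continuousAt_const (y := m u₀ + 1)) (by simp)]
    with u hu hlt
  have hr : 0 ≤ r u := by rw [h.eq u hu]; positivity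
  calc ∑ i, pd i r u ^ 2 ≤ ∑ i, 4 * (r u * ∑ k, pd i (f k) u ^ 2) := by
        refine Finset.sum_le_sum fun i _ => ?_
        rw [h.pd_eq hu, mul_pow, h.eq u hu]
        have := Finset.sum_mul_sq_le_sq_mul_sq Finset.univ (fun k => f k u) fun k => pd i (f k) u
        linarith
    _ = 4 * m u * r u := by
        simp only [hm, Finset.mul_sum, Finset.sum_mul]
        exact Finset.sum_congr rfl fun _ _ => Finset.sum_congr rfl fun _ _ => by ring
    _ ≤ _ := by gcongr

/-- This upper bound on `r` is what makes the integral of 1/(ε² + r)² diverge; the lower bound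
`ge_eventually` keeps the bubble integrals bounded. -/
theorem le_eventually (h : IsSquareDistance U G u₀ f r) :
    ∃ C, ∀ᶠ u in nhds u₀, r u ≤ C * ‖u - u₀‖ ^ 2 := by
  have hU := h.isOpen.mem_nhds h.mem
  have hd : ∀ k, ∃ C, ∀ᶠ u in nhds u₀, |f k u| ≤ C * ‖u - u₀‖ := fun k => by
    have := (((h.smooth k).contDiffAt hU).differentiableAt (by simp)).hasFDerivAt.isBigO_sub
    obtain ⟨C, hC⟩ := this.bound
    refine ⟨C, hC.mono fun u hu => ?_⟩
    simpa [h.zero] using hu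
  choose C hC using hd
  refine ⟨∑ k, C k ^ 2, ?_⟩
  filter_upwards [hU, Filter.eventually_all.2 hC] with u hu hk
  rw [h.eq u hu, Finset.sum_mul]
  refine Finset.sum_le_sum fun k _ => ?_
  rw [← sq_abs, ← mul_pow]
  exact pow_le_pow_left₀ (abs_nonneg _) (hk k) 2

/-- As G = DᵀD is nondegenerate, the differential of (f_k) at `u₀` is injective, so (f_k) has
exactly the order of u - u₀. -/
theorem ge_eventually (h : IsSquareDistance U G u₀ f r) (hG : (G u₀).PosDef) :
    ∃ κ > 0, ∀ᶠ u in nhds u₀, κ * ‖u - u₀‖ ^ 2 ≤ r u := by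
  have hU := h.isOpen.mem_nhds h.mem
  have hd : HasFDerivAt (fun u => fun k => f k u)
      (ContinuousLinearMap.pi fun k => fderiv ℝ (f k) u₀) u₀ :=
    hasFDerivAt_pi.2 fun k =>
      (((h.smooth k).contDiffAt hU).differentiableAt (by simp)).hasFDerivAt
  have hinj : LinearMap.ker (ContinuousLinearMap.pi fun k => fderiv ℝ (f k) u₀).toLinearMap = ⊥ := by
    rw [LinearMap.ker_eq_bot']
    intro v hv
    have hv' : ∀ k, ∑ i, v i * pd i (f k) u₀ = 0 := fun k => by
      rw [← fderiv_eq_sum_pd]; exact congrFun hv k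
    have : (G u₀).mulVec v.ofLp = 0 := by
      rw [h.matrix_eq, ← Matrix.mulVec_mulVec]
      have : (Matrix.of fun k i => pd i (f k) u₀).mulVec v.ofLp = 0 := by
        ext k
        simpa [Matrix.mulVec, dotProduct, mul_comm] using hv' k
      rw [this, Matrix.mulVec_zero]
    have := Matrix.eq_zero_of_mulVec_eq_zero hG.det_pos.ne' this
    ext i; exact congrFun this i
  obtain ⟨K, -, hK⟩ := LinearMap.exists_antilipschitzWith _ hinj
  obtain ⟨C, hC0, hC⟩ := (hd.isTheta_sub
    (hK.isUniformInducing (ContinuousLinearMap.uniformContinuous _)).isInducing).2.exists_pos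
  refine ⟨(C ^ 2)⁻¹, by positivity, ?_⟩
  filter_upwards [hU, hC.bound] with u hu hb
  rw [inv_mul_le_iff₀ (by positivity), h.eq u hu]
  have hn : ‖(fun k => f k u) - fun k => f k u₀‖ ^ 2 ≤ ∑ k, f k u ^ 2 := by
    have h0 : 0 ≤ ∑ k, f k u ^ 2 := by positivity
    rw [← Real.le_sqrt (norm_nonneg _) h0, pi_norm_le_iff_of_nonneg (Real.sqrt_nonneg _)]
    intro k
    rw [Real.le_sqrt (norm_nonneg _) h0]
    simpa [h.zero] using Finset.single_le_sum (f := fun k => f k u ^ 2)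
      (fun k _ => sq_nonneg _) (Finset.mem_univ k)
  calc ‖u - u₀‖ ^ 2 ≤ (C * ‖(fun k => f k u) - fun k => f k u₀‖) ^ 2 :=
        pow_le_pow_left₀ (norm_nonneg _) hb 2
    _ ≤ _ := by rw [mul_pow]; gcongr

end IsSquareDistance
end Local

/-! ### The metric in charts and its transformation law. -/

section manifold
variable {M : Type*} [TopologicalSpace M] [ChartedSpace E4 M] [IsManifold (𝓡 4) ∞ M]

theorem injective_mfderiv_chart_symm (c : M) {u : E4} (hu : u ∈ (chartAt E4 c).target) :
    Function.Injective (mfderiv (𝓡 4) (𝓡 4) (chartAt E4 c).symm u) := 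
  (mdifferentiable_chart (I := 𝓡 4) c).symm.mfderiv_injective hu

omit [IsManifold (𝓡 4) ∞ M] in
theorem sum_smul_coordVec (c : M) (u : E4) (x : Fin 4 → ℝ) :
    ∑ i, x i • coordVec c i u =
      mfderiv (𝓡 4) (𝓡 4) (chartAt E4 c).symm u (WithLp.toLp 2 x : E4) := by
  have : (WithLp.toLp 2 x : E4) = ∑ i, x i • EuclideanSpace.single i (1 : ℝ) := by
    ext j; simp [Finset.sum_apply, Pi.single_apply]
  rw [this]
  simp only [coordVec]
  erw [map_sum]
  refine Finset.sum_congr rfl fun i _ => ?_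
  erw [map_smul]

theorem posDef_metricMatrix (g : Metric4 M) (c : M) {u : E4} (hu : u ∈ (chartAt E4 c).target) :
    (metricMatrix g c u).PosDef := by
  refine Matrix.PosDef.of_dotProduct_mulVec_pos ?_ fun x hx => ?_
  · ext i j
    simp [metricMatrix, g.symm]
  · have h0 : (∑ i, x i • coordVec c i u) ≠ 0 := by
      rw [sum_smul_coordVec]
      intro h
      have := injective_mfderiv_chart_symm c hu (h.trans (map_zero _).symm)
      exact hx (congrArg WithLp.ofLp this)
    have := g.pos _ _ h0
    simp only [map_sum, map_smul, FunLike.coe_sum, Finset.sum_apply, FunLike.coe_smul,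
      Pi.smul_apply, smul_eq_mul, Finset.mul_sum] at this
    rw [Finset.sum_comm] at this
    simpa [metricMatrix, dotProduct, Matrix.mulVec, Finset.mul_sum, mul_assoc, mul_comm,
      mul_left_comm] using this

theorem contMDiffOn_coordVec (c : M) (i : Fin 4) :
    ContMDiffOn (𝓡 4) (𝓡 4).tangent ∞
      (fun u => (⟨(chartAt E4 c).symm u, coordVec c i u⟩ : TangentBundle (𝓡 4) M))
      (chartAt E4 c).target := by
  have ho := (chartAt E4 c).open_target
  have h1 := (contMDiffOn_chart_symm (I := 𝓡 4) (n := ∞) (x := c)).contMDiffOn_tangentMapWithin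
    (m := ∞) (by simp) ho.uniqueMDiffOn
  have h2 : ContMDiff (𝓡 4) (𝓡 4).tangent ∞
      (fun u : E4 => (⟨u, EuclideanSpace.single i (1 : ℝ)⟩ : TangentBundle (𝓡 4) E4)) := by
    have := (contMDiff_vectorSpace_iff_contDiff (𝕜 := ℝ) (E := E4) (n := ∞)
      (V := fun _ => EuclideanSpace.single i (1 : ℝ))).2 contDiff_const
    exact this
  refine (h1.comp h2.contMDiffOn fun u hu => hu).congr fun u hu => ?_
  simp only [Function.comp, tangentMapWithin, coordVec, mfderivWithin_of_isOpen ho hu]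

theorem contDiffOn_metricMatrix (g : Metric4 M) (c : M) (i j : Fin 4) :
    ContDiffOn ℝ ∞ (fun u => metricMatrix g c u i j) (chartAt E4 c).target := by
  have h1 := g.contMDiff.comp_contMDiffOn (contMDiffOn_chart_symm (I := 𝓡 4) (n := ∞) (x := c))
  have h2 := ContMDiffOn.clm_bundle_apply₂ (F₁ := E4) (F₂ := E4) (F₃ := ℝ)
    (E₁ := fun x : M => TangentSpace (𝓡 4) x) (E₂ := fun x : M => TangentSpace (𝓡 4) x)
    (E₃ := Bundle.Trivial M ℝ) h1 (contMDiffOn_coordVec c i) (contMDiffOn_coordVec c j)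
  intro u hu
  have := h2 u hu
  simp only [Bundle.contMDiffWithinAt_totalSpace] at this
  exact contMDiffWithinAt_iff_contDiffWithinAt.1 this.2

theorem isSmoothMetric (g : Metric4 M) (c : M) :
    IsSmoothMetric (chartAt E4 c).target (metricMatrix g c) where
  isOpen := (chartAt E4 c).open_target
  smooth := contDiffOn_metricMatrix g c
  posDef := fun _ hu => posDef_metricMatrix g c hu

/-- Two chart descriptions of one point agree only propositionally, while all tangent spaces are
`E4` by definition; this moves vectors between the two descriptions. -/
theorem inner_congr (g : Metric4 M) {x y : M} (h : x = y) (v w : E4) :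
    g.inner x (v : TangentSpace (𝓡 4) x) (w : TangentSpace (𝓡 4) x) =
      g.inner y (v : TangentSpace (𝓡 4) y) (w : TangentSpace (𝓡 4) y) := by
  subst h; rfl

/-- The transition from the chart around `c` to the chart around `p`. -/
noncomputable def transition (p c : M) (u : E4) : E4 := chartAt E4 p ((chartAt E4 c).symm u)

omit [IsManifold (𝓡 4) ∞ M] in
theorem isOpen_overlap (p c : M) : IsOpen
    ((chartAt E4 c).target ∩ (chartAt E4 c).symm ⁻¹' (chartAt E4 p).source) :=
  (chartAt E4 c).isOpen_inter_preimage_symm (chartAt E4 p).open_source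

theorem contDiffOn_transition (p c : M) : ContDiffOn ℝ ∞ (transition p c)
    ((chartAt E4 c).target ∩ (chartAt E4 c).symm ⁻¹' (chartAt E4 p).source) :=
  contMDiffOn_iff_contDiffOn.1
    ((contMDiffOn_chart (I := 𝓡 4) (n := ∞) (x := p)).comp
      ((contMDiffOn_chart_symm (I := 𝓡 4) (n := ∞) (x := c)).mono Set.inter_subset_left)
      fun _ hu => hu.2)

theorem coordVec_transition (p c : M) {u : E4} (hu : u ∈ (chartAt E4 c).target)
    (hup : (chartAt E4 c).symm u ∈ (chartAt E4 p).source) (i : Fin 4) :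
    (coordVec c i u : E4) = ∑ a, pd i (fun v => transition p c v a) u •
      (coordVec p a (transition p c u) : E4) := by
  have hO := (isOpen_overlap p c).mem_nhds ⟨hu, hup⟩
  have hd : DifferentiableAt ℝ (transition p c) u :=
    ((contDiffOn_transition p c).contDiffAt hO).differentiableAt (by simp)
  have e : (chartAt E4 c).symm =ᶠ[𝓝 u] (chartAt E4 p).symm ∘ transition p c := by
    filter_upwards [hO] with v hv
    simp [transition, (chartAt E4 p).left_inv hv.2]
  have h1 : mfderiv (𝓡 4) (𝓡 4) (chartAt E4 c).symm u =
      (mfderiv (𝓡 4) (𝓡 4) (chartAt E4 p).symm (transition p c u)).comp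
        (mfderiv (𝓡 4) (𝓡 4) (transition p c) u) := by
    rw [← mfderiv_comp u ((mdifferentiable_chart (I := 𝓡 4) p).symm.mdifferentiableAt
      ((chartAt E4 p).map_source hup)) hd.mdifferentiableAt]
    exact e.mfderiv_eq
  have h2 := sum_smul_coordVec p (transition p c u)
    fun a => pd i (fun v => transition p c v a) u
  have h3 : (WithLp.toLp 2 fun a => pd i (fun v => transition p c v a) u : E4) =
      fderiv ℝ (transition p c) u (EuclideanSpace.single i 1) := by
    ext a
    simp only [pd]
    have : HasFDerivAt (fun v => transition p c v a)
      ((EuclideanSpace.proj a).comp (fderiv ℝ (transition p c) u)) u :=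
      (EuclideanSpace.proj (𝕜 := ℝ) a).hasFDerivAt.comp u hd.hasFDerivAt
    rw [this.fderiv]; rfl
  rw [h3] at h2
  refine Eq.trans ?_ h2.symm
  simp only [coordVec]
  rw [h1, mfderiv_eq_fderiv]; rfl

/-- The tensor law for the metric, the only invariance under coordinate changes that is needed: it
carries the orthonormal coframe at `p` from the preferred chart to any other. -/
theorem metricMatrix_transition (g : Metric4 M) (p c : M) {u : E4}
    (hu : u ∈ (chartAt E4 c).target)
    (hup : (chartAt E4 c).symm u ∈ (chartAt E4 p).source) (i j : Fin 4) :
    metricMatrix g c u i j = ∑ a, ∑ b, pd i (fun v => transition p c v a) u *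
      pd j (fun v => transition p c v b) u * metricMatrix g p (transition p c u) a b := by
  have hx : (chartAt E4 c).symm u = (chartAt E4 p).symm (transition p c u) := by
    simp [transition, (chartAt E4 p).left_inv hup]
  simp only [metricMatrix, Matrix.of_apply]
  refine (inner_congr g hx (coordVec c i u) (coordVec c j u)).trans ?_
  rw [coordVec_transition p c hu hup i, coordVec_transition p c hu hup j]
  have hbil : ∀ (B : E4 →L[ℝ] E4 →L[ℝ] ℝ) (x y : Fin 4 → ℝ) (v w : Fin 4 → E4),
      B (∑ a, x a • v a) (∑ b, y b • w b) = ∑ a, ∑ b, x a * y b * B (v a) (w b) := by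
    intro B x y v w
    simp only [map_sum, map_smul, FunLike.coe_sum, Finset.sum_apply, FunLike.coe_smul,
      Pi.smul_apply, smul_eq_mul, Finset.mul_sum]
    rw [Finset.sum_comm]
    exact Finset.sum_congr rfl fun _ _ => Finset.sum_congr rfl fun _ _ => by ring
  exact hbil (g.inner ((chartAt E4 p).symm (transition p c u))) _ _ _ _

end manifold

/-! ### A global function resembling the squared distance to a point. -/

open scoped MatrixOrder in
theorem exists_transpose_mul_self {A : Matrix (Fin 4) (Fin 4) ℝ} (hA : A.PosDef) :
    ∃ L : Matrix (Fin 4) (Fin 4) ℝ, A = L.transpose * L := by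
  obtain ⟨L, hL⟩ := CStarAlgebra.nonneg_iff_eq_star_mul_self.mp hA.posSemidef.nonneg
  exact ⟨L, by rw [hL, Matrix.star_eq_conjTranspose,
    Matrix.conjTranspose_eq_transpose_of_trivial]⟩

section manifold
variable {M : Type*} [TopologicalSpace M] [ChartedSpace E4 M] [IsManifold (𝓡 4) ∞ M]

/-- `ρ` is a smooth function that is positive away from `p` and that is, in all charts around `p`,
a square distance to `p` to leading order. -/
structure IsDistSqLike (g : Metric4 M) (p : M) (ρ : M → ℝ) : Prop where
  smooth : ContMDiff (𝓡 4) 𝓘(ℝ, ℝ) ∞ ρ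
  nonneg : ∀ x, 0 ≤ ρ x
  eq_of_zero : ∀ x, ρ x = 0 → x = p
  local_form : ∀ c, p ∈ (chartAt E4 c).source → ∃ V ⊆ (chartAt E4 c).target, ∃ f,
    IsSquareDistance V (metricMatrix g c) (chartAt E4 c p) f
      fun u => ρ ((chartAt E4 c).symm u)

/-- Factor the metric at `p` as LᵀL. The rows of L give linear functions `F k` whose differentials
are an orthonormal coframe at `p`; their sum of squares `q` is glued to the constant 1 by a bump
function `b`, as b q + (1 - b). In another chart the `F k` are composed with the transition map. -/
theorem exists_isDistSqLike [T2Space M] (g : Metric4 M) (p : M) : ∃ ρ, IsDistSqLike g p ρ := by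
  obtain ⟨L, hL⟩ := exists_transpose_mul_self
    (posDef_metricMatrix g p (mem_chart_target E4 p))
  have hLdet : L.det ≠ 0 := by
    have := (posDef_metricMatrix g p (mem_chart_target E4 p)).det_pos
    rw [hL, Matrix.det_mul, Matrix.det_transpose] at this
    exact fun h0 => by simp [h0] at this
  let F : Fin 4 → E4 → ℝ := fun k y => ∑ j, L k j * (y j - chartAt E4 p p j)
  have hF : ∀ k, ContDiff ℝ ∞ (F k) := fun k => by
    refine ContDiff.sum fun j _ => contDiff_const.mul (ContDiff.sub ?_ contDiff_const)
    exact (EuclideanSpace.proj (𝕜 := ℝ) j).contDiff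
  let b : SmoothBumpFunction (𝓡 4) p := Classical.arbitrary _
  let q : M → ℝ := fun x => ∑ k, F k (chartAt E4 p x) ^ 2
  have hq : ContMDiffOn (𝓡 4) 𝓘(ℝ, ℝ) ∞ q (chartAt E4 p).source :=
    (ContDiff.contMDiff (f := fun y : E4 => ∑ k, F k y ^ 2)
      (ContDiff.sum fun k _ => (hF k).pow 2)).comp_contMDiffOn
        (contMDiffOn_chart (I := 𝓡 4) (n := ∞) (x := p))
  have hq0 : ∀ x, 0 ≤ q x := fun x => Finset.sum_nonneg fun k _ => sq_nonneg _
  refine ⟨fun x => b x • q x + (1 - b x), (b.contMDiff_smul hq).add (contMDiff_const.sub b.contMDiff),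
    fun x => add_nonneg (mul_nonneg b.nonneg (hq0 x)) (sub_nonneg.2 b.le_one), ?_, ?_⟩
  · intro x hx
    have h1 : 0 ≤ b x • q x := mul_nonneg b.nonneg (hq0 x)
    have h2 : 0 ≤ 1 - b x := sub_nonneg.2 b.le_one
    -- Both summands are nonnegative with sum zero, so 1 - b vanishes, and then so does `q`.
    have hb : b x = 1 := by linarith
    have hs : x ∈ (chartAt E4 p).source := b.support_subset_source (by simp [hb])
    have hqx : q x = 0 := by rw [hb, one_smul] at hx; linarith
    have hFk : ∀ k, F k (chartAt E4 p x) = 0 := fun k => by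
      have := (Finset.sum_eq_zero_iff_of_nonneg fun k _ => sq_nonneg _).1 hqx k (Finset.mem_univ k)
      exact pow_eq_zero_iff (two_ne_zero) |>.1 this
    have hz := Matrix.eq_zero_of_mulVec_eq_zero hLdet
      (v := fun j => chartAt E4 p x j - chartAt E4 p p j) (funext hFk)
    refine (chartAt E4 p).injOn hs (mem_chart_source E4 p) ?_
    ext j
    exact sub_eq_zero.1 (congrFun hz j)
  · intro c hc
    set e := chartAt E4 c
    have hup : e.symm (e p) = p := e.left_inv hc
    have hO := isOpen_overlap p c
    have hmem : e p ∈ e.target ∩ e.symm ⁻¹' (chartAt E4 p).source :=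
      ⟨e.map_source hc, by simp [hup]⟩
    have hbev : ∀ᶠ u in 𝓝 (e p), b (e.symm u) = 1 := by
      have hcont : Filter.Tendsto e.symm (𝓝 (e p)) (𝓝 p) := by
        have := e.continuousAt_symm (e.map_source hc)
        rwa [ContinuousAt, hup] at this
      exact hcont.eventually b.eventuallyEq_one
    obtain ⟨W, hW, hWo, hWm⟩ := mem_nhds_iff.1 hbev
    refine ⟨(e.target ∩ e.symm ⁻¹' (chartAt E4 p).source) ∩ W, fun u hu => hu.1.1,
      fun k u => F k (transition p c u), ⟨hmem, hWm⟩, hO.inter hWo, fun k => ?_, fun k => ?_, ?_, ?_⟩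
    · exact (hF k).comp_contDiffOn ((contDiffOn_transition p c).mono Set.inter_subset_left)
    · simp [F, transition, e, hup]
    · intro i j
      have ht : transition p c (e p) = chartAt E4 p p := by simp [transition, e, hup]
      have hd : DifferentiableAt ℝ (transition p c) (e p) :=
        ((contDiffOn_transition p c).contDiffAt (hO.mem_nhds hmem)).differentiableAt (by simp)
      have hda : ∀ a, DifferentiableAt ℝ (fun v => transition p c v a) (e p) := fun a =>
        (EuclideanSpace.proj (𝕜 := ℝ) a).differentiableAt.comp _ hd
      have hpd : ∀ i k, pd i (fun u => F k (transition p c u)) (e p) =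
          ∑ a, L k a * pd i (fun v => transition p c v a) (e p) := fun i k => by
        simp only [F]
        rw [pd_sum _ fun a _ => ((hda a).sub_const _).const_mul _]
        refine Finset.sum_congr rfl fun a _ => ?_
        simp only [pd]
        rw [fderiv_const_mul ((hda a).sub_const _), fderiv_sub_const]; simp
      rw [metricMatrix_transition g p c hmem.1 hmem.2, ht, hL]
      simp only [hpd, Matrix.mul_apply, Matrix.transpose_apply, Finset.mul_sum, Finset.sum_mul]
      simp only [Fin.sum_univ_four]
      ring
    · intro u hu
      have : b (e.symm u) = 1 := hW hu.2
      simp [this, q, transition, e]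

end manifold

/-! ### Integration with the partition of unity. -/

section manifold
variable {M : Type*} [TopologicalSpace M] [ChartedSpace E4 M] [IsManifold (𝓡 4) ∞ M]
  [T2Space M] [CompactSpace M]

/-- A function on `M`, given by its expressions in the charts, all of which are continuous. -/
def IsContinuousFamily (f : M → E4 → ℝ) : Prop :=
  ∀ c : M, ContinuousOn (f c) (chartAt E4 c).target

/-- The image in the chart around `c` of the support of the partition function of that chart. -/
def chartSupport (c : M) : Set E4 := chartAt E4 c '' tsupport (chartPartition M c)

theorem isCompact_chartSupport (c : M) : IsCompact (chartSupport c) :=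
  (isClosed_tsupport _).isCompact.image_of_continuousOn
    ((chartAt E4 c).continuousOn.mono (chartPartition_isSubordinate c))

theorem chartSupport_subset (c : M) : chartSupport c ⊆ (chartAt E4 c).target := by
  rintro _ ⟨x, hx, rfl⟩
  exact (chartAt E4 c).map_source (chartPartition_isSubordinate c hx)

/-- The density of the integral in the chart around `c`. -/
noncomputable def chartWeight (g : Metric4 M) (c : M) (u : E4) : ℝ :=
  chartPartition M c ((chartAt E4 c).symm u) * Real.sqrt (metricMatrix g c u).det

theorem chartWeight_nonneg (g : Metric4 M) (c : M) (u : E4) : 0 ≤ chartWeight g c u :=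
  mul_nonneg ((chartPartition M).nonneg c _) (Real.sqrt_nonneg _)

theorem chartWeight_eq_zero (g : Metric4 M) (c : M) {u : E4} (hu : u ∈ (chartAt E4 c).target)
    (hs : u ∉ chartSupport c) : chartWeight g c u = 0 := by
  have : chartPartition M c ((chartAt E4 c).symm u) = 0 := by
    refine image_eq_zero_of_notMem_tsupport fun h => hs ⟨_, h, ?_⟩
    exact (chartAt E4 c).right_inv hu
  simp [chartWeight, this]

theorem continuousOn_chartWeight (g : Metric4 M) (c : M) :
    ContinuousOn (chartWeight g c) (chartAt E4 c).target :=
  ((chartPartition M c).contMDiff.continuous.comp_continuousOn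
    (chartAt E4 c).continuousOn_symm).mul
      (contDiffOn_det (contDiffOn_metricMatrix g c)).continuousOn.sqrt

variable (M) in
/-- The finite set of the centers of the charts that contribute to integrals over `M`. -/
noncomputable def activeCharts : Finset M :=
  ((chartPartition M).locallyFinite.finite_nonempty_of_compact).toFinset

theorem chartSupport_eq_empty {c : M} (hc : c ∉ activeCharts M) : chartSupport c = ∅ := by
  have : Function.support (chartPartition M c) = ∅ := by
    simpa [activeCharts, Set.not_nonempty_iff_eq_empty] using hc
  simp [chartSupport, tsupport, this]

theorem integral_eq_sum (g : Metric4 M) (f : M → E4 → ℝ) :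
    integral g f =
      ∑ c ∈ activeCharts M, ∫ u in (chartAt E4 c).target, chartWeight g c u * f c u := by
  have e : ∀ c : M, (∫ u in (chartAt E4 c).target,
      chartPartition M c ((chartAt E4 c).symm u) * f c u * Real.sqrt (metricMatrix g c u).det) =
      ∫ u in (chartAt E4 c).target, chartWeight g c u * f c u := fun c => by
    congr 1; ext u; simp only [chartWeight]; ring
  simp only [integral, e]
  refine finsum_eq_sum_of_support_subset _ fun c hc => ?_
  by_contra h
  refine hc ?_
  refine setIntegral_eq_zero_of_forall_eq_zero fun u hu => ?_
  rw [chartWeight_eq_zero g c hu (by simp [chartSupport_eq_empty h]), zero_mul]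

theorem integrableOn_chartWeight_mul (g : Metric4 M) {f : M → E4 → ℝ} (hf : IsContinuousFamily f)
    (c : M) : IntegrableOn (fun u => chartWeight g c u * f c u) (chartAt E4 c).target := by
  refine IntegrableOn.of_forall_sdiff_eq_zero (s := chartSupport c) ?_
    (chartAt E4 c).open_target.measurableSet fun u hu => ?_
  · exact (((continuousOn_chartWeight g c).mul (hf c)).mono
      (chartSupport_subset c)).integrableOn_compact (isCompact_chartSupport c)
  · rw [chartWeight_eq_zero g c hu.1 hu.2, zero_mul]

theorem integral_add (g : Metric4 M) {f h : M → E4 → ℝ} (hf : IsContinuousFamily f)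
    (hh : IsContinuousFamily h) :
    integral g (fun c u => f c u + h c u) = integral g f + integral g h := by
  simp only [integral_eq_sum, ← Finset.sum_add_distrib]
  refine Finset.sum_congr rfl fun c _ => ?_
  rw [← MeasureTheory.integral_add (integrableOn_chartWeight_mul g hf c)
    (integrableOn_chartWeight_mul g hh c)]
  simp only [mul_add]

theorem integral_const_mul (g : Metric4 M) (a : ℝ) (f : M → E4 → ℝ) :
    integral g (fun c u => a * f c u) = a * integral g f := by
  simp only [integral_eq_sum, Finset.mul_sum, ← MeasureTheory.integral_const_mul]
  refine Finset.sum_congr rfl fun c _ => ?_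
  simp only [mul_left_comm]

theorem integral_congr (g : Metric4 M) {f h : M → E4 → ℝ}
    (e : ∀ c, ∀ u ∈ (chartAt E4 c).target, f c u = h c u) : integral g f = integral g h := by
  simp only [integral_eq_sum]
  refine Finset.sum_congr rfl fun c _ => setIntegral_congr_fun
    (chartAt E4 c).open_target.measurableSet fun u hu => ?_
  simp only [e c u hu]

/-- The comparison is required only on the compact sets `chartSupport c`, where uniform bounds are
available; elsewhere the weight vanishes. -/
theorem integral_mono (g : Metric4 M) {f h : M → E4 → ℝ} (hf : IsContinuousFamily f)
    (hh : IsContinuousFamily h) (e : ∀ c, ∀ u ∈ chartSupport c, f c u ≤ h c u) :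
    integral g f ≤ integral g h := by
  simp only [integral_eq_sum]
  refine Finset.sum_le_sum fun c _ => setIntegral_mono_on (integrableOn_chartWeight_mul g hf c)
    (integrableOn_chartWeight_mul g hh c) (chartAt E4 c).open_target.measurableSet fun u hu => ?_
  by_cases hs : u ∈ chartSupport c
  · exact mul_le_mul_of_nonneg_left (e c u hs) (chartWeight_nonneg g c u)
  · simp [chartWeight_eq_zero g c hu hs]

omit [IsManifold (𝓡 4) ∞ M] [T2Space M] [CompactSpace M] in
theorem isContinuousFamily_const (a : ℝ) : IsContinuousFamily (fun (_ : M) _ => a) :=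
  fun _ => continuousOn_const

theorem exists_chartWeight_pos (g : Metric4 M) (p : M) :
    ∃ c ∈ activeCharts M, p ∈ (chartAt E4 c).source ∧ 0 < chartWeight g c (chartAt E4 c p) := by
  obtain ⟨c, hc⟩ := (chartPartition M).exists_pos_of_mem (Set.mem_univ p)
  have hp : p ∈ (chartAt E4 c).source :=
    chartPartition_isSubordinate c (subset_tsupport _ (Function.mem_support.2 hc.ne'))
  refine ⟨c, ?_, hp, ?_⟩
  · simp only [activeCharts, Set.Finite.mem_toFinset, Set.mem_ofPred_eq]
    exact ⟨p, hc.ne'⟩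
  · refine mul_pos ?_ (Real.sqrt_pos.2 (posDef_metricMatrix g c ((chartAt E4 c).map_source hp)).det_pos)
    rwa [(chartAt E4 c).left_inv hp]

/-- The integral of a nonnegative function is at least its contribution from a single chart. -/
theorem le_integral (g : Metric4 M) {f : M → E4 → ℝ}
    (h0 : ∀ c, ∀ u ∈ (chartAt E4 c).target, 0 ≤ f c u) {c : M} (hc : c ∈ activeCharts M) :
    ∫ u in (chartAt E4 c).target, chartWeight g c u * f c u ≤ integral g f := by
  rw [integral_eq_sum]
  exact Finset.single_le_sum
    (f := fun c => ∫ u in (chartAt E4 c).target, chartWeight g c u * f c u)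
    (fun c _ => setIntegral_nonneg (chartAt E4 c).open_target.measurableSet fun u hu =>
      mul_nonneg (chartWeight_nonneg g c u) (h0 c u hu)) hc

theorem integral_pos (g : Metric4 M) {f : M → E4 → ℝ} (hf : IsContinuousFamily f)
    (h0 : ∀ c, ∀ u ∈ (chartAt E4 c).target, 0 ≤ f c u) {c : M} (hc : c ∈ activeCharts M)
    {u : E4} (hu : u ∈ (chartAt E4 c).target) (hw : 0 < chartWeight g c u) (hfu : 0 < f c u) :
    0 < integral g f := by
  refine lt_of_lt_of_le ?_ (le_integral g h0 hc)
  have hcont : ContinuousOn (fun u => chartWeight g c u * f c u) (chartAt E4 c).target :=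
    (continuousOn_chartWeight g c).mul (hf c)
  rw [setIntegral_pos_iff_support_of_nonneg_ae]
  · have hop := hcont.isOpen_inter_preimage (chartAt E4 c).open_target
      (isOpen_compl_singleton (x := (0 : ℝ)))
    rw [Set.inter_comm]
    exact hop.measure_pos _ ⟨u, hu, (mul_pos hw hfu).ne'⟩
  · exact (ae_restrict_iff' (chartAt E4 c).open_target.measurableSet).2
      (Filter.Eventually.of_forall fun u hu => mul_nonneg (chartWeight_nonneg g c u) (h0 c u hu))
  · exact integrableOn_chartWeight_mul g hf c

theorem volume_pos [Nonempty M] (g : Metric4 M) : 0 < integral g fun _ _ => 1 := by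
  obtain ⟨c, hc, hp, hw⟩ := exists_chartWeight_pos g (Classical.arbitrary M)
  exact integral_pos g (isContinuousFamily_const 1) (fun _ _ _ => zero_le_one) hc
    ((chartAt E4 c).map_source hp) hw one_pos

/-- The form "for all large C" lets finitely many such bounds share a single constant by
intersecting filters. -/
theorem eventually_abs_le {f : M → E4 → ℝ} (hf : IsContinuousFamily f) :
    ∀ᶠ C in Filter.atTop, ∀ c, ∀ u ∈ chartSupport c, |f c u| ≤ C := by
  have h1 : ∀ c ∈ activeCharts M, ∀ᶠ C in Filter.atTop, ∀ u ∈ chartSupport c, |f c u| ≤ C := by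
    intro c _
    obtain ⟨C, hC⟩ := (isCompact_chartSupport c).exists_bound_of_continuousOn
      ((hf c).mono (chartSupport_subset c))
    filter_upwards [Filter.eventually_ge_atTop C] with D hD u hu using (hC u hu).trans hD
  filter_upwards [(Filter.eventually_all_finset _).2 h1] with C hC c u hu
  by_cases hc : c ∈ activeCharts M
  · exact hC c hc u hu
  · simp [chartSupport_eq_empty hc] at hu

end manifold

/-! ### Smooth functions in charts and the functionals evaluated on them. -/

section manifold
variable {M : Type*} [TopologicalSpace M] [ChartedSpace E4 M] [IsManifold (𝓡 4) ∞ M]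

/-- The expression of a function on `M` in the chart around `c`. -/
def chartExpr (w : M → ℝ) (c : M) (u : E4) : ℝ := w ((chartAt E4 c).symm u)

/-- The Laplacian of a smooth function in the chart around `c`. -/
noncomputable def lapOf (g : Metric4 M) (w : M → ℝ) (c : M) (u : E4) : ℝ :=
  lap (metricMatrix g c) (fun i => pd i (chartExpr w c) u)
    (fun i j => pd i (pd j (chartExpr w c)) u) u

/-- The squared length of the gradient of a smooth function in the chart around `c`. -/
noncomputable def gradSqOf (g : Metric4 M) (w : M → ℝ) (c : M) (u : E4) : ℝ :=
  gradNormSq (metricMatrix g c) (fun i => pd i (chartExpr w c) u) u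

/-- `Ric(∇w, ∇w)` for a smooth function `w` in the chart around `c`. -/
noncomputable def ricGradOf (g : Metric4 M) (w : M → ℝ) (c : M) (u : E4) : ℝ :=
  ricGrad (metricMatrix g c) (fun i => pd i (chartExpr w c) u) u

theorem contDiffOn_chartExpr {w : M → ℝ} (hw : ContMDiff (𝓡 4) 𝓘(ℝ, ℝ) ∞ w) (c : M) :
    ContDiffOn ℝ ∞ (chartExpr w c) (chartAt E4 c).target :=
  contMDiffOn_iff_contDiffOn.1
    (hw.comp_contMDiffOn (contMDiffOn_chart_symm (I := 𝓡 4) (n := ∞) (x := c)))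

theorem contDiffOn_pd_chartExpr {w : M → ℝ} (hw : ContMDiff (𝓡 4) 𝓘(ℝ, ℝ) ∞ w) (c : M)
    (i : Fin 4) : ContDiffOn ℝ ∞ (pd i (chartExpr w c)) (chartAt E4 c).target :=
  contDiffOn_pd (chartAt E4 c).open_target (contDiffOn_chartExpr hw c) i

theorem isContinuousFamily_chartExpr {w : M → ℝ} (hw : ContMDiff (𝓡 4) 𝓘(ℝ, ℝ) ∞ w) :
    IsContinuousFamily (chartExpr w) := fun c => (contDiffOn_chartExpr hw c).continuousOn

theorem isContinuousFamily_lapOf (g : Metric4 M) {w : M → ℝ}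
    (hw : ContMDiff (𝓡 4) 𝓘(ℝ, ℝ) ∞ w) : IsContinuousFamily (lapOf g w) := fun c =>
  ((isSmoothMetric g c).lap (contDiffOn_pd_chartExpr hw c) fun i j =>
    contDiffOn_pd (chartAt E4 c).open_target (contDiffOn_pd_chartExpr hw c j) i).continuousOn

theorem isContinuousFamily_gradSqOf (g : Metric4 M) {w : M → ℝ}
    (hw : ContMDiff (𝓡 4) 𝓘(ℝ, ℝ) ∞ w) : IsContinuousFamily (gradSqOf g w) := fun c =>
  ((isSmoothMetric g c).gradNormSq (contDiffOn_pd_chartExpr hw c)).continuousOn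

theorem isContinuousFamily_ricGradOf (g : Metric4 M) {w : M → ℝ}
    (hw : ContMDiff (𝓡 4) 𝓘(ℝ, ℝ) ∞ w) : IsContinuousFamily (ricGradOf g w) := fun c =>
  ((isSmoothMetric g c).ricGrad (contDiffOn_pd_chartExpr hw c)).continuousOn

theorem gradSqOf_nonneg (g : Metric4 M) (w : M → ℝ) {c : M} {u : E4}
    (hu : u ∈ (chartAt E4 c).target) : 0 ≤ gradSqOf g w c u :=
  gradNormSq_nonneg (posDef_metricMatrix g c hu) _

/-- A smooth function as an element of `W^{2,2}`. -/
noncomputable def W22.ofSmooth (w : M → ℝ) (hw : ContMDiff (𝓡 4) 𝓘(ℝ, ℝ) ∞ w) : W22 M where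
  toFun := w
  d1 c i := pd i (chartExpr w c)
  d2 c i j := pd i (pd j (chartExpr w c))
  memL2 c := memL2Loc_of_continuousOn (contDiffOn_chartExpr hw c).continuousOn
  memL2_d1 c i := memL2Loc_of_continuousOn (contDiffOn_pd_chartExpr hw c i).continuousOn
  memL2_d2 c i j := memL2Loc_of_continuousOn
    (contDiffOn_pd (chartAt E4 c).open_target (contDiffOn_pd_chartExpr hw c j) i).continuousOn
  weak_d1 c i := hasWeakPartial_pd (chartAt E4 c).open_target (contDiffOn_chartExpr hw c) i
  weak_d2 c i j := hasWeakPartial_pd (chartAt E4 c).open_target (contDiffOn_pd_chartExpr hw c j) i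

section comp

variable (g : Metric4 M) {ρ : M → ℝ} (hρ : ContMDiff (𝓡 4) 𝓘(ℝ, ℝ) ∞ ρ) {h : ℝ → ℝ} {I : Set ℝ}
  (hI : IsOpen I) (hh : ContDiffOn ℝ ∞ h I) (hρI : ∀ x, ρ x ∈ I)

include hρ hI hh hρI

omit [IsManifold (𝓡 4) ∞ M] in
theorem contMDiff_comp_of_contDiffOn : ContMDiff (𝓡 4) 𝓘(ℝ, ℝ) ∞ fun x => h (ρ x) := fun x =>
  (hh.contDiffAt (hI.mem_nhds (hρI x))).contMDiffAt.comp x hρ.contMDiffAt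

theorem pd_chartExpr_comp {c : M} {u : E4} (hu : u ∈ (chartAt E4 c).target) (i : Fin 4) :
    pd i (chartExpr (fun x => h (ρ x)) c) u =
      deriv h (chartExpr ρ c u) * pd i (chartExpr ρ c) u :=
  pd_comp (((contDiffOn_chartExpr hρ c).contDiffAt
      ((chartAt E4 c).open_target.mem_nhds hu)).differentiableAt (by simp))
    ((hh.contDiffAt (hI.mem_nhds (hρI _))).differentiableAt (by simp)) i

theorem lapOf_comp {c : M} {u : E4} (hu : u ∈ (chartAt E4 c).target) :
    lapOf g (fun x => h (ρ x)) c u = deriv h (chartExpr ρ c u) * lapOf g ρ c u +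
      deriv (deriv h) (chartExpr ρ c u) * gradSqOf g ρ c u := by
  have h2 : ∀ i j, pd i (pd j (chartExpr (fun x => h (ρ x)) c)) u = _ := fun i j =>
    pd_pd_comp (chartAt E4 c).open_target (contDiffOn_chartExpr hρ c) hI hh (fun v _ => hρI _) hu i j
  simp only [lapOf, pd_chartExpr_comp hρ hI hh hρI hu, h2, gradSqOf]
  exact lap_comp _ _ _ _ _

theorem gradSqOf_comp {c : M} {u : E4} (hu : u ∈ (chartAt E4 c).target) :
    gradSqOf g (fun x => h (ρ x)) c u = deriv h (chartExpr ρ c u) ^ 2 * gradSqOf g ρ c u := by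
  simp only [gradSqOf, pd_chartExpr_comp hρ hI hh hρI hu]
  exact gradNormSq_smul _ _ _

theorem ricGradOf_comp {c : M} {u : E4} (hu : u ∈ (chartAt E4 c).target) :
    ricGradOf g (fun x => h (ρ x)) c u = deriv h (chartExpr ρ c u) ^ 2 * ricGradOf g ρ c u := by
  simp only [ricGradOf, pd_chartExpr_comp hρ hI hh hρI hu]
  exact ricGrad_smul _ _ _

end comp

variable [T2Space M] [CompactSpace M]

/-- The common form of the functionals `γ₁ I + γ₂ II + γ₃ III` and `γ₁ I + γ₂ II' + γ₃ III` on
smooth functions: the terms linear in `w` are collected in `∫ Z w dv`, and `Λ` is the coefficient of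
`log ⨍ e^{4w} dv`. -/
noncomputable def smoothFunctional (γ₂ γ₃ Λ : ℝ) (Z : M → E4 → ℝ) (g : Metric4 M)
    (w : M → ℝ) : ℝ :=
  integral g (fun c u =>
      γ₂ * (lapOf g w c u ^ 2 + 2 / 3 * scal (metricMatrix g c) u * gradSqOf g w c u
        - 2 * ricGradOf g w c u)
      + 12 * γ₃ * (lapOf g w c u + gradSqOf g w c u) ^ 2
      - 4 * γ₃ * (scal (metricMatrix g c) u * gradSqOf g w c u) + Z c u * chartExpr w c u)
    + Λ * Real.log (mean g fun c u => Real.exp (4 * chartExpr w c u))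

/-- For a = w̄ this turns the normalization in II' into a term linear in `w`. -/
theorem log_mean_exp_sub_const [Nonempty M] (g : Metric4 M)
    {w : M → ℝ} (hw : ContMDiff (𝓡 4) 𝓘(ℝ, ℝ) ∞ w) (a : ℝ) :
    Real.log (mean g fun c u => Real.exp (4 * (chartExpr w c u - a))) =
      Real.log (mean g fun c u => Real.exp (4 * chartExpr w c u)) - 4 * a := by
  have hc : IsContinuousFamily fun c u => Real.exp (4 * chartExpr w c u) := fun c =>
    (continuousOn_const.mul (isContinuousFamily_chartExpr hw c)).rexp
  have hpos : 0 < integral g fun c u => Real.exp (4 * chartExpr w c u) := by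
    obtain ⟨c, hc', hp, hw⟩ := exists_chartWeight_pos g (Classical.arbitrary M)
    exact integral_pos g hc (fun _ _ _ => (Real.exp_pos _).le) hc'
      ((chartAt E4 c).map_source hp) hw (Real.exp_pos _)
  have e : (mean g fun c u => Real.exp (4 * (chartExpr w c u - a))) =
      Real.exp (-(4 * a)) * mean g fun c u => Real.exp (4 * chartExpr w c u) := by
    rw [mean, mean, ← mul_div_assoc, ← integral_const_mul]
    congr 2
    ext c u
    rw [← Real.exp_add]; ring_nf
  have hm : 0 < mean g fun c u => Real.exp (4 * chartExpr w c u) := div_pos hpos (volume_pos g)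
  rw [e, Real.log_mul (Real.exp_pos _).ne' hm.ne', Real.log_exp]
  ring

section curvature
variable (g : Metric4 M)
omit [T2Space M] [CompactSpace M]

theorem isContinuousFamily_scal : IsContinuousFamily fun c u => scal (metricMatrix g c) u :=
  fun c => (isSmoothMetric g c).scal.continuousOn

theorem isContinuousFamily_weyl : IsContinuousFamily fun c u => weylNormSq (metricMatrix g c) u :=
  fun c => (isSmoothMetric g c).weylNormSq.continuousOn

theorem isContinuousFamily_qCurv : IsContinuousFamily fun c u => qCurv (metricMatrix g c) u :=
  fun c => (isSmoothMetric g c).qCurv.continuousOn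

theorem isContinuousFamily_lapScal : IsContinuousFamily fun c u => lapScal (metricMatrix g c) u :=
  fun c => (isSmoothMetric g c).lapScal.continuousOn

end curvature

/-- Four summands suffice for every use; shorter sums are padded with zero. -/
theorem integral_linear_combination (g : Metric4 M) {f₁ f₂ f₃ f₄ : M → E4 → ℝ} (a₁ a₂ a₃ a₄ : ℝ)
    (h₁ : IsContinuousFamily f₁) (h₂ : IsContinuousFamily f₂) (h₃ : IsContinuousFamily f₃)
    (h₄ : IsContinuousFamily f₄) :
    integral g (fun c u => a₁ * f₁ c u + a₂ * f₂ c u + a₃ * f₃ c u + a₄ * f₄ c u) =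
      a₁ * integral g f₁ + a₂ * integral g f₂ + a₃ * integral g f₃ + a₄ * integral g f₄ := by
  have k₁ : IsContinuousFamily fun c u => a₁ * f₁ c u := fun c => continuousOn_const.mul (h₁ c)
  have k₂ : IsContinuousFamily fun c u => a₂ * f₂ c u := fun c => continuousOn_const.mul (h₂ c)
  have k₃ : IsContinuousFamily fun c u => a₃ * f₃ c u := fun c => continuousOn_const.mul (h₃ c)
  have k₄ : IsContinuousFamily fun c u => a₄ * f₄ c u := fun c => continuousOn_const.mul (h₄ c)
  have k₁₂ : IsContinuousFamily fun c u => a₁ * f₁ c u + a₂ * f₂ c u :=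
    fun c => (k₁ c).add (k₂ c)
  have k₁₂₃ : IsContinuousFamily fun c u => a₁ * f₁ c u + a₂ * f₂ c u + a₃ * f₃ c u :=
    fun c => (k₁₂ c).add (k₃ c)
  rw [integral_add g k₁₂₃ k₄, integral_add g k₁₂ k₃, integral_add g k₁ k₂]
  simp only [integral_const_mul]

theorem smoothFunctional_eq (γ₂ γ₃ Λ : ℝ) {Z : M → E4 → ℝ} (hZ : IsContinuousFamily Z)
    (g : Metric4 M) {w : M → ℝ} (hw : ContMDiff (𝓡 4) 𝓘(ℝ, ℝ) ∞ w) :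
    smoothFunctional γ₂ γ₃ Λ Z g w = γ₂ * paneitzForm g (W22.ofSmooth w hw)
      + 12 * γ₃ * integral g (fun c u => (lapOf g w c u + gradSqOf g w c u) ^ 2)
      + -4 * γ₃ * integral g (fun c u => scal (metricMatrix g c) u * gradSqOf g w c u)
      + 1 * integral g (fun c u => Z c u * chartExpr w c u)
      + Λ * Real.log (mean g fun c u => Real.exp (4 * chartExpr w c u)) := by
  have hl := isContinuousFamily_lapOf g hw
  have hb := isContinuousFamily_gradSqOf g hw
  have ht := isContinuousFamily_ricGradOf g hw
  have hR := isContinuousFamily_scal g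
  have hx := isContinuousFamily_chartExpr hw
  rw [smoothFunctional, paneitzForm, ← integral_linear_combination]
  · congr 2
    ext c u
    simp only [W22.laplacian, W22.gradSq, W22.ofSmooth, lapOf, gradSqOf, ricGradOf]
    ring
  · intro c
    exact (((hl c).pow 2).add ((continuousOn_const.mul (hR c)).mul (hb c))).sub
      (continuousOn_const.mul (ht c))
  · exact fun c => ((hl c).add (hb c)).pow 2
  · exact fun c => (hR c).mul (hb c)
  · exact fun c => (hZ c).mul (hx c)

theorem detFunctional_ofSmooth (γ₁ γ₂ γ₃ : ℝ) (g : Metric4 M) :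
    ∃ (Λ : ℝ) (Z : M → E4 → ℝ), IsContinuousFamily Z ∧
      ∀ w (hw : ContMDiff (𝓡 4) 𝓘(ℝ, ℝ) ∞ w),
        detFunctional γ₁ γ₂ γ₃ g (W22.ofSmooth w hw) = smoothFunctional γ₂ γ₃ Λ Z g w := by
  have hW := isContinuousFamily_weyl g
  have hQ := isContinuousFamily_qCurv g
  have hL := isContinuousFamily_lapScal g
  have hZ : IsContinuousFamily fun c u => 4 * γ₁ * weylNormSq (metricMatrix g c) u +
      4 * γ₂ * qCurv (metricMatrix g c) u + -4 * γ₃ * lapScal (metricMatrix g c) u := fun c =>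
    ((continuousOn_const.mul (hW c)).add (continuousOn_const.mul (hQ c))).add
      (continuousOn_const.mul (hL c))
  refine ⟨-(γ₁ * integral g (fun c u => weylNormSq (metricMatrix g c) u) + γ₂ * totalQ g), _, hZ,
    fun w hw => ?_⟩
  have hx := isContinuousFamily_chartExpr hw
  have hR := isContinuousFamily_scal g
  have hb := isContinuousFamily_gradSqOf g hw
  have e := integral_linear_combination g (4 * γ₁) (4 * γ₂) (-4 * γ₃) 0
    (f₁ := fun c u => chartExpr w c u * weylNormSq (metricMatrix g c) u)
    (f₂ := fun c u => qCurv (metricMatrix g c) u * chartExpr w c u)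
    (f₃ := fun c u => chartExpr w c u * lapScal (metricMatrix g c) u) (f₄ := fun _ _ => 0)
    (fun c => (hx c).mul (hW c)) (fun c => (hQ c).mul (hx c)) (fun c => (hx c).mul (hL c))
    (isContinuousFamily_const 0)
  have e' := integral_congr g (f := fun c u => (4 * γ₁ * weylNormSq (metricMatrix g c) u +
      4 * γ₂ * qCurv (metricMatrix g c) u + -4 * γ₃ * lapScal (metricMatrix g c) u) *
        chartExpr w c u) fun c u _ => by
    show _ = 4 * γ₁ * (chartExpr w c u * weylNormSq (metricMatrix g c) u) +
      4 * γ₂ * (qCurv (metricMatrix g c) u * chartExpr w c u) +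
      -4 * γ₃ * (chartExpr w c u * lapScal (metricMatrix g c) u) + 0 * 0
    ring
  have e3 := integral_add g (f := fun c u => chartExpr w c u * lapScal (metricMatrix g c) u)
    (h := fun c u => scal (metricMatrix g c) u * gradSqOf g w c u)
    (fun c => (hx c).mul (hL c)) (fun c => (hR c).mul (hb c))
  rw [smoothFunctional_eq γ₂ γ₃ _ hZ g hw, e', e, detFunctional, funcI, funcII, funcIII]
  change _ * (4 * integral g (fun c u => chartExpr w c u * weylNormSq (metricMatrix g c) u)
    - _ * Real.log (mean g fun c u => Real.exp (4 * chartExpr w c u))) + _ *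
    (_ + 4 * integral g (fun c u => qCurv (metricMatrix g c) u * chartExpr w c u) -
      _ * Real.log (mean g fun c u => Real.exp (4 * chartExpr w c u))) +
    _ * (12 * integral g (fun c u => (lapOf g w c u + gradSqOf g w c u) ^ 2) -
      4 * integral g (fun c u => chartExpr w c u * lapScal (metricMatrix g c) u +
        scal (metricMatrix g c) u * gradSqOf g w c u)) = _
  rw [e3]
  ring

theorem detFunctional'_ofSmooth [Nonempty M] (γ₁ γ₂ γ₃ : ℝ) (g : Metric4 M) :
    ∃ (Λ : ℝ) (Z : M → E4 → ℝ), IsContinuousFamily Z ∧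
      ∀ w (hw : ContMDiff (𝓡 4) 𝓘(ℝ, ℝ) ∞ w),
        detFunctional' γ₁ γ₂ γ₃ g (W22.ofSmooth w hw) = smoothFunctional γ₂ γ₃ Λ Z g w := by
  have hW := isContinuousFamily_weyl g
  have hL := isContinuousFamily_lapScal g
  -- The mean of Q replaces Q in the linear term: subtracting w̄ in the exponent contributes 4 (∫ Q)
  -- w̄ = 4 q ∫ w.
  set q : ℝ := totalQ g / integral g fun _ _ => 1 with hq
  have hZ : IsContinuousFamily fun c u => 4 * γ₁ * weylNormSq (metricMatrix g c) u +
      4 * γ₂ * q + -4 * γ₃ * lapScal (metricMatrix g c) u := fun c =>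
    ((continuousOn_const.mul (hW c)).add continuousOn_const).add
      (continuousOn_const.mul (hL c))
  refine ⟨-(γ₁ * integral g (fun c u => weylNormSq (metricMatrix g c) u) + γ₂ * totalQ g), _, hZ,
    fun w hw => ?_⟩
  have hx := isContinuousFamily_chartExpr hw
  have hR := isContinuousFamily_scal g
  have hb := isContinuousFamily_gradSqOf g hw
  have e := integral_linear_combination g (4 * γ₁) (4 * γ₂ * q) (-4 * γ₃) 0
    (f₁ := fun c u => chartExpr w c u * weylNormSq (metricMatrix g c) u)
    (f₂ := fun c u => chartExpr w c u)
    (f₃ := fun c u => chartExpr w c u * lapScal (metricMatrix g c) u) (f₄ := fun _ _ => 0)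
    (fun c => (hx c).mul (hW c)) hx (fun c => (hx c).mul (hL c))
    (isContinuousFamily_const 0)
  have e' := integral_congr g (f := fun c u => (4 * γ₁ * weylNormSq (metricMatrix g c) u +
      4 * γ₂ * q + -4 * γ₃ * lapScal (metricMatrix g c) u) * chartExpr w c u) fun c u _ => by
    show _ = 4 * γ₁ * (chartExpr w c u * weylNormSq (metricMatrix g c) u) +
      4 * γ₂ * q * chartExpr w c u +
      -4 * γ₃ * (chartExpr w c u * lapScal (metricMatrix g c) u) + 0 * 0
    ring
  have e3 := integral_add g (f := fun c u => chartExpr w c u * lapScal (metricMatrix g c) u)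
    (h := fun c u => scal (metricMatrix g c) u * gradSqOf g w c u)
    (fun c => (hx c).mul (hL c)) (fun c => (hR c).mul (hb c))
  rw [smoothFunctional_eq γ₂ γ₃ _ hZ g hw, e', e, detFunctional', funcI, funcII', funcIII]
  change _ * (4 * integral g (fun c u => chartExpr w c u * weylNormSq (metricMatrix g c) u)
    - _ * Real.log (mean g fun c u => Real.exp (4 * chartExpr w c u))) + _ *
    (_ - _ * Real.log (mean g fun c u => Real.exp
      (4 * (chartExpr w c u - mean g (chartExpr w))))) +
    _ * (12 * integral g (fun c u => (lapOf g w c u + gradSqOf g w c u) ^ 2) -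
      4 * integral g (fun c u => chartExpr w c u * lapScal (metricMatrix g c) u +
        scal (metricMatrix g c) u * gradSqOf g w c u)) = _
  rw [e3, log_mean_exp_sub_const g hw, hq]
  have hm : mean g (chartExpr w) = integral g (chartExpr w) / integral g fun _ _ => 1 := rfl
  rw [hm]
  ring

end manifold

/-! ### Unboundedness from above. -/

section manifold
variable {M : Type*} [TopologicalSpace M] [ChartedSpace E4 M] [IsManifold (𝓡 4) ∞ M]
  [T2Space M] [CompactSpace M]

namespace IsDistSqLike

variable {g : Metric4 M} {p : M} {ρ : M → ℝ}

omit [T2Space M] [CompactSpace M] in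
theorem chartExpr_pos (h : IsDistSqLike g p ρ) {c : M} {u : E4}
    (hu : u ∈ (chartAt E4 c).target)
    (hne : p ∈ (chartAt E4 c).source → u ≠ chartAt E4 c p) : 0 < chartExpr ρ c u := by
  refine lt_of_le_of_ne (h.nonneg _) fun h0 => ?_
  have hx := h.eq_of_zero _ h0.symm
  have hp : p ∈ (chartAt E4 c).source := hx ▸ (chartAt E4 c).map_target hu
  exact hne hp (by rw [← hx, (chartAt E4 c).right_inv hu])

/-- Near `p` one has |∇ρ|² ≥ 3ρ, which is positive away from `p`. -/
theorem integral_gradSqOf_sq_pos (h : IsDistSqLike g p ρ) :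
    0 < integral g fun c u => gradSqOf g ρ c u ^ 2 := by
  obtain ⟨c, hc, hp, hw⟩ := exists_chartWeight_pos g p
  obtain ⟨V, hV, f, hf⟩ := h.local_form c hp
  have ht := (chartAt E4 c).map_source hp
  have hm : IsSmoothMetric V (metricMatrix g c) :=
    ⟨hf.isOpen, fun i j => (contDiffOn_metricMatrix g c i j).mono hV,
      fun u hu => posDef_metricMatrix g c (hV hu)⟩
  have h1 := hf.gradNormSq_eventually hm one_pos
  have h2 : ∀ᶠ u in 𝓝 (chartAt E4 c p), 0 < chartWeight g c u :=
    ((continuousOn_chartWeight g c).continuousAt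
      ((chartAt E4 c).open_target.mem_nhds ht)).eventually (lt_mem_nhds hw)
  have h3 := (chartAt E4 c).open_target.mem_nhds ht
  -- The point must differ from `p`, where the gradient vanishes, so it is taken in a punctured
  -- neighbourhood.
  obtain ⟨u, ⟨⟨⟨hB, hw'⟩, hu⟩, hne⟩⟩ := ((((h1.and h2).and h3).filter_mono
    nhdsWithin_le_nhds).and (self_mem_nhdsWithin (s := {chartAt E4 c p}ᶜ))).exists
  have hpos := h.chartExpr_pos hu fun _ => hne
  have hBpos : 0 < gradSqOf g ρ c u := by
    have := (abs_le.1 hB).1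
    change _ ≤ gradSqOf g ρ c u - 4 * chartExpr ρ c u at this
    change -(1 * chartExpr ρ c u) ≤ _ at this
    linarith
  exact integral_pos g (fun c => (isContinuousFamily_gradSqOf g h.smooth c).pow 2)
    (fun _ _ _ => sq_nonneg _) hc hu hw' (by positivity)

end IsDistSqLike

theorem abs_log_mean_exp_le [Nonempty M] (g : Metric4 M) {f : M → E4 → ℝ}
    (hf : IsContinuousFamily f) {B : ℝ} (hB : ∀ c, ∀ u ∈ chartSupport c, |f c u| ≤ B) :
    |Real.log (mean g fun c u => Real.exp (f c u))| ≤ B := by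
  have hV := volume_pos g
  have he : IsContinuousFamily fun c u => Real.exp (f c u) := fun c => (hf c).rexp
  have h1 : Real.exp (-B) ≤ mean g fun c u => Real.exp (f c u) := by
    rw [mean, le_div_iff₀ hV, ← integral_const_mul]
    refine integral_mono g (fun _ => continuousOn_const) he fun c u hu => ?_
    simpa using (abs_le.1 (hB c u hu)).1
  have h2 : (mean g fun c u => Real.exp (f c u)) ≤ Real.exp B := by
    rw [mean, div_le_iff₀ hV, ← integral_const_mul]
    refine integral_mono g he (fun _ => continuousOn_const) fun c u hu => ?_
    simpa using (abs_le.1 (hB c u hu)).2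
  rw [abs_le]
  exact ⟨(Real.le_log_iff_exp_le ((Real.exp_pos _).trans_le h1)).2 h1,
    (Real.log_le_iff_le_exp ((Real.exp_pos _).trans_le h1)).2 h2⟩

/-- Along `w = t ρ` the quartic term of the functional dominates. -/
theorem exists_le_smoothFunctional [Nonempty M] {γ₂ γ₃ Λ : ℝ} (hγ : 0 < γ₃) {Z : M → E4 → ℝ}
    (hZ : IsContinuousFamily Z) (g : Metric4 M) (N : ℝ) :
    ∃ w, ∃ _ : ContMDiff (𝓡 4) 𝓘(ℝ, ℝ) ∞ w, N ≤ smoothFunctional γ₂ γ₃ Λ Z g w := by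
  obtain ⟨ρ, h⟩ := exists_isDistSqLike g (Classical.arbitrary M)
  have hA := isContinuousFamily_lapOf g h.smooth
  have hB := isContinuousFamily_gradSqOf g h.smooth
  have hT := isContinuousFamily_ricGradOf g h.smooth
  have hR := isContinuousFamily_scal g
  have hx := isContinuousFamily_chartExpr h.smooth
  obtain ⟨R, hRb, hR0⟩ := ((eventually_abs_le hx).and (Filter.eventually_ge_atTop 0)).exists
  set f₁ : M → E4 → ℝ := fun c u => gradSqOf g ρ c u ^ 2 with hf₁
  set f₂ : M → E4 → ℝ := fun c u => 24 * γ₃ * (lapOf g ρ c u * gradSqOf g ρ c u) with hf₂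
  set f₃ : M → E4 → ℝ := fun c u => γ₂ * (lapOf g ρ c u ^ 2 +
    2 / 3 * scal (metricMatrix g c) u * gradSqOf g ρ c u - 2 * ricGradOf g ρ c u) +
    12 * γ₃ * lapOf g ρ c u ^ 2 - 4 * γ₃ * (scal (metricMatrix g c) u * gradSqOf g ρ c u) with hf₃
  set f₄ : M → E4 → ℝ := fun c u => Z c u * chartExpr ρ c u with hf₄
  have k₁ : IsContinuousFamily f₁ := fun c => (hB c).pow 2
  have k₂ : IsContinuousFamily f₂ := fun c => continuousOn_const.mul ((hA c).mul (hB c))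
  have k₃ : IsContinuousFamily f₃ := fun c =>
    ((continuousOn_const.mul ((((hA c).pow 2).add ((continuousOn_const.mul (hR c)).mul (hB c))).sub
      (continuousOn_const.mul (hT c)))).add (continuousOn_const.mul ((hA c).pow 2))).sub
      (continuousOn_const.mul ((hR c).mul (hB c)))
  have k₄ : IsContinuousFamily f₄ := fun c => (hZ c).mul (hx c)
  have hpos : 0 < 12 * γ₃ * integral g f₁ := by
    have := h.integral_gradSqOf_sq_pos
    positivity
  have hd : ∀ t : ℝ, deriv (fun x => t * x) = fun _ => t := fun t => by
    ext x; simp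
  have hsm : ∀ t : ℝ, ContDiffOn ℝ ∞ (fun x : ℝ => t * x) Set.univ := fun t =>
    (contDiff_const.mul contDiff_id).contDiffOn
  have hsmooth : ∀ t : ℝ, ContMDiff (𝓡 4) 𝓘(ℝ, ℝ) ∞ fun x => t * ρ x := fun t =>
    contMDiff_comp_of_contDiffOn h.smooth isOpen_univ (hsm t) fun _ => Set.mem_univ _
  -- Along w = tρ the functional is a quartic polynomial in t plus the logarithmic term, which is
  -- O(t).
  have key : ∀ t : ℝ, smoothFunctional γ₂ γ₃ Λ Z g (fun x => t * ρ x) =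
      12 * γ₃ * t ^ 4 * integral g f₁ + t ^ 3 * integral g f₂ + t ^ 2 * integral g f₃ +
        t * integral g f₄ +
        Λ * Real.log (mean g fun c u => Real.exp (4 * (t * chartExpr ρ c u))) := fun t => by
    rw [smoothFunctional, ← integral_linear_combination g _ _ _ _ k₁ k₂ k₃ k₄]
    refine congrArg₂ _ (integral_congr g fun c u hu => ?_) rfl
    have e0 : chartExpr (fun x => t * ρ x) c u = t * chartExpr ρ c u := rfl
    have e1 := lapOf_comp g h.smooth isOpen_univ (hsm t) (fun _ => Set.mem_univ _) hu
    have e2 := gradSqOf_comp g h.smooth isOpen_univ (hsm t) (fun _ => Set.mem_univ _) hu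
    have e3 := ricGradOf_comp g h.smooth isOpen_univ (hsm t) (fun _ => Set.mem_univ _) hu
    simp only [hd, deriv_const] at e1 e2 e3
    rw [e0, e1, e2, e3]
    simp only [hf₁, hf₂, hf₃, hf₄]
    ring
  set K := |integral g f₂| + |integral g f₃| + |integral g f₄| + |Λ| * (4 * R) with hK
  have hK0 : 0 ≤ K := by positivity
  set a := 12 * γ₃ * integral g f₁ with ha
  -- This choice gives t ≥ 1 and a t ≥ K + |N|. Everything except the quartic term is at least -K
  -- t³, so the value is at least t³ (a t - K) ≥ |N|.
  set t := 1 + (K + |N|) / a with htdef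
  have ht1 : 1 ≤ t := by
    have : 0 ≤ (K + |N|) / a := by positivity
    linarith
  have hat : K + |N| ≤ a * t := by
    have : a * t = a + (K + |N|) := by rw [htdef]; field_simp
    linarith
  refine ⟨_, hsmooth t, ?_⟩
  rw [key]
  have hlog : |Real.log (mean g fun c u => Real.exp (4 * (t * chartExpr ρ c u)))| ≤ 4 * (t * R) := by
    refine abs_log_mean_exp_le g (fun c => continuousOn_const.mul (continuousOn_const.mul (hx c)))
      fun c u hu => ?_
    change |4 * (t * chartExpr ρ c u)| ≤ _
    rw [abs_mul, abs_mul, abs_of_pos (by norm_num : (0 : ℝ) < 4), abs_of_pos (by linarith : 0 < t)]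
    have := hRb c u hu
    gcongr
  have b1 : t ≤ t ^ 3 := le_self_pow₀ ht1 (by norm_num)
  have b2 : t ^ 2 ≤ t ^ 3 := pow_le_pow_right₀ ht1 (by norm_num)
  have ht3 : 1 ≤ t ^ 3 := one_le_pow₀ ht1
  have c2 : -(t ^ 3 * |integral g f₂|) ≤ t ^ 3 * integral g f₂ := by
    have := neg_abs_le (integral g f₂)
    nlinarith
  have c3 : -(t ^ 3 * |integral g f₃|) ≤ t ^ 2 * integral g f₃ := by
    have h1 := neg_abs_le (integral g f₃)
    have h2 : t ^ 2 * |integral g f₃| ≤ t ^ 3 * |integral g f₃| := by gcongr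
    nlinarith [sq_nonneg t]
  have c4 : -(t ^ 3 * |integral g f₄|) ≤ t * integral g f₄ := by
    have h1 := neg_abs_le (integral g f₄)
    have h2 : t * |integral g f₄| ≤ t ^ 3 * |integral g f₄| := by gcongr
    nlinarith
  have c5 : -(t ^ 3 * (|Λ| * (4 * R))) ≤
      Λ * Real.log (mean g fun c u => Real.exp (4 * (t * chartExpr ρ c u))) := by
    refine le_trans ?_ (neg_abs_le _)
    rw [abs_mul, neg_le_neg_iff]
    calc _ ≤ |Λ| * (4 * (t * R)) := by gcongr
      _ = t * (|Λ| * (4 * R)) := by ring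
      _ ≤ _ := by gcongr
  have : N ≤ t ^ 3 * (a * t - K) := by
    have h1 := le_abs_self N
    have h2 : |N| ≤ a * t - K := by linarith
    calc N ≤ 1 * |N| := by linarith
      _ ≤ t ^ 3 * (a * t - K) := by gcongr
  have e : t ^ 3 * (a * t - K) = 12 * γ₃ * t ^ 4 * integral g f₁ - t ^ 3 * K := by
    rw [ha]; ring
  have e' : t ^ 3 * K = t ^ 3 * |integral g f₂| + t ^ 3 * |integral g f₃| +
      t ^ 3 * |integral g f₄| + t ^ 3 * (|Λ| * (4 * R)) := by rw [hK]; ring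
  linarith

end manifold

/-! ### Estimates for ρ that are uniform over the charts. -/

section manifold
variable {M : Type*} [TopologicalSpace M] [ChartedSpace E4 M] [IsManifold (𝓡 4) ∞ M]
  [T2Space M] [CompactSpace M]

theorem eventually_forall_chartSupport {l : Filter ℝ} {P : ℝ → M → E4 → Prop}
    (h : ∀ c, ∀ᶠ C in l, ∀ u ∈ chartSupport c, P C c u) :
    ∀ᶠ C in l, ∀ c, ∀ u ∈ chartSupport c, P C c u := by
  filter_upwards [(Filter.eventually_all_finset (activeCharts M)).2 fun c _ => h c] with C hC c u hu
  by_cases hc : c ∈ activeCharts M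
  · exact hC c hc u hu
  · simp [chartSupport_eq_empty hc] at hu

namespace IsDistSqLike

variable {g : Metric4 M} {p : M} {ρ : M → ℝ}

/-- Outside a neighbourhood of `p` the chart support is compact and ρ has a positive minimum there,
so small ρ forces the point into the neighbourhood. Germs at `p` thus become statements on sublevel
sets of ρ; in a chart that misses `p` the neighbourhood is empty. -/
theorem exists_forall_of_eventually (h : IsDistSqLike g p ρ) (c : M) {P : E4 → Prop}
    (hP : p ∈ (chartAt E4 c).source → ∀ᶠ u in 𝓝 (chartAt E4 c p), P u) :
    ∃ δ > 0, ∀ u ∈ chartSupport c, chartExpr ρ c u < δ → P u := by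
  obtain ⟨N, hNo, hNP, hNp⟩ : ∃ N : Set E4, IsOpen N ∧ (∀ u ∈ N, P u) ∧
      (p ∈ (chartAt E4 c).source → chartAt E4 c p ∈ N) := by
    by_cases hp : p ∈ (chartAt E4 c).source
    · obtain ⟨N, h1, h2, h3⟩ := mem_nhds_iff.1 (hP hp)
      exact ⟨N, h2, fun u hu => h1 hu, fun _ => h3⟩
    · exact ⟨∅, isOpen_empty, by simp, fun h => absurd h hp⟩
  have hK : IsCompact (chartSupport c \ N) := (isCompact_chartSupport c).diff hNo
  have hpos : ∀ u ∈ chartSupport c \ N, 0 < chartExpr ρ c u := fun u hu =>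
    h.chartExpr_pos (chartSupport_subset c hu.1) fun hp e => hu.2 (e ▸ hNp hp)
  rcases (chartSupport c \ N).eq_empty_or_nonempty with he | hne
  · refine ⟨1, one_pos, fun u hu _ => hNP u ?_⟩
    by_contra hN
    exact (he ▸ (⟨hu, hN⟩ : u ∈ chartSupport c \ N) : u ∈ (∅ : Set E4))
  · obtain ⟨u₁, hu₁, hmin⟩ := hK.exists_isMinOn hne
      ((isContinuousFamily_chartExpr h.smooth c).mono
        (Set.sdiff_subset.trans (chartSupport_subset c)))
    refine ⟨_, hpos u₁ hu₁, fun u hu hlt => hNP u ?_⟩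
    by_contra hN
    exact absurd (hmin ⟨hu, hN⟩) (not_le.2 hlt)

theorem exists_near (h : IsDistSqLike g p ρ) {η : ℝ} (hη : 0 < η) :
    ∃ δ > 0, ∀ c, ∀ u ∈ chartSupport c, chartExpr ρ c u < δ →
      |lapOf g ρ c u - 8| ≤ η ∧ |gradSqOf g ρ c u - 4 * chartExpr ρ c u| ≤ η * chartExpr ρ c u := by
  have key : ∀ᶠ δ in 𝓝[>] (0 : ℝ), ∀ c, ∀ u ∈ chartSupport c, chartExpr ρ c u < δ →
      |lapOf g ρ c u - 8| ≤ η ∧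
        |gradSqOf g ρ c u - 4 * chartExpr ρ c u| ≤ η * chartExpr ρ c u := by
    refine eventually_forall_chartSupport fun c => ?_
    obtain ⟨δ, hδ, H⟩ := h.exists_forall_of_eventually c (P := fun u => |lapOf g ρ c u - 8| ≤ η ∧
        |gradSqOf g ρ c u - 4 * chartExpr ρ c u| ≤ η * chartExpr ρ c u) fun hp => by
      obtain ⟨V, hV, f, hf⟩ := h.local_form c hp
      have ht := (chartAt E4 c).map_source hp
      have hm : IsSmoothMetric V (metricMatrix g c) :=
        ⟨hf.isOpen, fun i j => (contDiffOn_metricMatrix g c i j).mono hV,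
          fun u hu => posDef_metricMatrix g c (hV hu)⟩
      have h8 : lapOf g ρ c (chartAt E4 c p) = 8 := hf.lap_eq (posDef_metricMatrix g c ht)
      have hc := (isContinuousFamily_lapOf g h.smooth c).continuousAt
        ((chartAt E4 c).open_target.mem_nhds ht)
      have h1 : ∀ᶠ u in 𝓝 (chartAt E4 c p), |lapOf g ρ c u - 8| ≤ η := by
        rw [ContinuousAt, h8, Metric.tendsto_nhds] at hc
        filter_upwards [hc η hη] with u hu using (by simpa [Real.dist_eq] using hu.le)
      exact h1.and (hf.gradNormSq_eventually hm hη)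
    filter_upwards [Ioo_mem_nhdsGT hδ] with x hx u hu hlt using H u hu (hlt.trans hx.2)
  obtain ⟨δ, hδ, hpos⟩ := (key.and self_mem_nhdsWithin).exists
  exact ⟨δ, hpos, hδ⟩

/-- Near `p` this is `sum_pd_sq_eventually`; where ρ ≥ δ the left side is bounded and ρ is bounded
below. -/
theorem eventually_sum_pd_sq_le (h : IsDistSqLike g p ρ) :
    ∀ᶠ C in Filter.atTop, ∀ c, ∀ u ∈ chartSupport c,
      ∑ i, pd i (chartExpr ρ c) u ^ 2 ≤ C * chartExpr ρ c u := by
  refine eventually_forall_chartSupport fun c => ?_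
  obtain ⟨C₁, δ, hδ, H⟩ : ∃ C₁, ∃ δ > 0, ∀ u ∈ chartSupport c, chartExpr ρ c u < δ →
      ∑ i, pd i (chartExpr ρ c) u ^ 2 ≤ C₁ * chartExpr ρ c u := by
    by_cases hp : p ∈ (chartAt E4 c).source
    · obtain ⟨V, hV, f, hf⟩ := h.local_form c hp
      obtain ⟨C₁, hC₁⟩ := hf.sum_pd_sq_eventually
      exact ⟨C₁, h.exists_forall_of_eventually c fun _ => hC₁⟩
    · exact ⟨0, h.exists_forall_of_eventually c fun hp' => absurd hp' hp⟩
  obtain ⟨C₂, hC₂⟩ := (isCompact_chartSupport c).exists_bound_of_continuousOn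
    (f := fun u => ∑ i, pd i (chartExpr ρ c) u ^ 2)
    ((continuousOn_finsetSum _ fun i _ =>
      (contDiffOn_pd_chartExpr h.smooth c i).continuousOn.pow 2).mono (chartSupport_subset c))
  filter_upwards [Filter.eventually_ge_atTop C₁, Filter.eventually_ge_atTop (C₂ / δ),
    Filter.eventually_ge_atTop 0] with C h1 h2 h3 u hu
  have hr : 0 ≤ chartExpr ρ c u := h.nonneg _
  by_cases hlt : chartExpr ρ c u < δ
  · exact (H u hu hlt).trans (by gcongr)
  · have := (le_abs_self _).trans (hC₂ u hu)
    rw [div_le_iff₀ hδ] at h2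
    exact this.trans (h2.trans (by gcongr; exact not_lt.1 hlt))

/-- A quadratic form in dρ with bounded coefficients is O(|dρ|²) = O(ρ). It serves for both |∇ρ|²
and Ric(∇ρ,∇ρ). -/
theorem eventually_abs_quadratic_le (h : IsDistSqLike g p ρ) {H : Fin 4 → Fin 4 → M → E4 → ℝ}
    (hH : ∀ i j, IsContinuousFamily (H i j)) :
    ∀ᶠ C in Filter.atTop, ∀ c, ∀ u ∈ chartSupport c,
      |∑ i, ∑ j, H i j c u * pd i (chartExpr ρ c) u * pd j (chartExpr ρ c) u| ≤
        C * chartExpr ρ c u := by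
  obtain ⟨B, hB, hB0⟩ := ((Filter.eventually_all.2 fun i => Filter.eventually_all.2 fun j =>
    eventually_abs_le (hH i j)).and (Filter.eventually_ge_atTop 0)).exists
  obtain ⟨D, hD⟩ := h.eventually_sum_pd_sq_le.exists
  filter_upwards [Filter.eventually_ge_atTop (B * (4 * D))] with C hC c u hu
  have hr : 0 ≤ chartExpr ρ c u := h.nonneg _
  calc _ ≤ ∑ i, ∑ j, B * (|pd i (chartExpr ρ c) u| * |pd j (chartExpr ρ c) u|) := by
        refine (Finset.abs_sum_le_sum_abs _ _).trans (Finset.sum_le_sum fun i _ => ?_)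
        refine (Finset.abs_sum_le_sum_abs _ _).trans (Finset.sum_le_sum fun j _ => ?_)
        rw [abs_mul, abs_mul, mul_assoc]
        have := hB i j c u hu
        gcongr
    _ = B * ∑ i, ∑ j, |pd i (chartExpr ρ c) u| * |pd j (chartExpr ρ c) u| := by
        simp only [Finset.mul_sum]
    _ ≤ B * (4 * ∑ i, pd i (chartExpr ρ c) u ^ 2) := by
        gcongr
        exact IsSquareDistance.sum_abs_mul_le _
    _ ≤ B * (4 * (D * chartExpr ρ c u)) := by have := hD c u hu; gcongr
    _ = B * (4 * D) * chartExpr ρ c u := by ring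
    _ ≤ _ := by gcongr

theorem eventually_gradSqOf_le (h : IsDistSqLike g p ρ) :
    ∀ᶠ C in Filter.atTop, ∀ c, ∀ u ∈ chartSupport c,
      gradSqOf g ρ c u ≤ C * chartExpr ρ c u := by
  filter_upwards [h.eventually_abs_quadratic_le
    (H := fun i j c u => ginv (metricMatrix g c) u i j)
    fun i j c => ((isSmoothMetric g c).ginv i j).continuousOn] with C hC c u hu
  exact (le_abs_self _).trans (hC c u hu)

theorem eventually_abs_ricGradOf_le (h : IsDistSqLike g p ρ) :
    ∀ᶠ C in Filter.atTop, ∀ c, ∀ u ∈ chartSupport c,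
      |ricGradOf g ρ c u| ≤ C * chartExpr ρ c u := by
  filter_upwards [h.eventually_abs_quadratic_le
    (H := fun a b c u => ∑ i, ∑ j, ginv (metricMatrix g c) u i a * ginv (metricMatrix g c) u j b *
      ric (metricMatrix g c) i j u)
    fun a b c => (ContDiffOn.sum fun i _ => ContDiffOn.sum fun j _ =>
      (((isSmoothMetric g c).ginv i a).mul ((isSmoothMetric g c).ginv j b)).mul
        ((isSmoothMetric g c).ric i j)).continuousOn] with C hC c u hu
  refine le_trans (le_of_eq (congrArg _ ?_)) (hC c u hu)
  simp only [ricGradOf, ricGrad, Fin.sum_univ_four]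
  ring

/-- In every chart, `ρ` dominates a squared Euclidean distance. -/
theorem exists_mul_norm_sq_le (h : IsDistSqLike g p ρ) (c : M) :
    ∃ u₀ : E4, ∃ κ > 0, ∀ u ∈ chartSupport c, κ * ‖u - u₀‖ ^ 2 ≤ chartExpr ρ c u := by
  obtain ⟨κ, hκ, δ, hδ, H⟩ : ∃ κ > 0, ∃ δ > 0, ∀ u ∈ chartSupport c, chartExpr ρ c u < δ →
      κ * ‖u - chartAt E4 c p‖ ^ 2 ≤ chartExpr ρ c u := by
    by_cases hp : p ∈ (chartAt E4 c).source
    · obtain ⟨V, hV, f, hf⟩ := h.local_form c hp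
      obtain ⟨κ, hκ, hk⟩ := hf.ge_eventually
        (posDef_metricMatrix g c ((chartAt E4 c).map_source hp))
      exact ⟨κ, hκ, h.exists_forall_of_eventually c fun _ => hk⟩
    · exact ⟨1, one_pos, h.exists_forall_of_eventually c fun hp' => absurd hp' hp⟩
  obtain ⟨C, hC⟩ := (isCompact_chartSupport c).exists_bound_of_continuousOn
    (f := fun u => ‖u - chartAt E4 c p‖ ^ 2) (by fun_prop)
  have hC1 : 0 < |C| + 1 := by positivity
  refine ⟨chartAt E4 c p, min κ (δ / (|C| + 1)), by positivity, fun u hu => ?_⟩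
  by_cases hlt : chartExpr ρ c u < δ
  · exact le_trans (by gcongr; exact min_le_left _ _) (H u hu hlt)
  · have h1 : ‖u - chartAt E4 c p‖ ^ 2 ≤ |C| + 1 := by
      have := (le_abs_self _).trans (hC u hu)
      linarith [le_abs_self C]
    calc _ ≤ δ / (|C| + 1) * (|C| + 1) := by gcongr; exact min_le_right _ _
      _ = δ := by field_simp
      _ ≤ _ := not_lt.1 hlt

end IsDistSqLike
end manifold

/-! ### Model integrals on ℝ⁴ and their transfer to the manifold. -/

theorem integrable_inv_one_add_norm_sq {κ : ℝ} (hκ : 0 < κ) :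
    Integrable fun v : E4 => ((1 + κ * ‖v‖ ^ 2) ^ 3)⁻¹ := by
  have h1 : Integrable fun v : E4 => (1 + ‖v‖ ^ 2) ^ (-(6 : ℝ) / 2) :=
    integrable_rpow_neg_one_add_norm_sq (by simp; norm_num)
  refine (h1.comp_smul (Real.sqrt_pos.2 hκ).ne').congr (Filter.Eventually.of_forall fun v => ?_)
  simp only [norm_smul, Real.norm_eq_abs, mul_pow, sq_abs, Real.sq_sqrt hκ.le]
  rw [show (-(6 : ℝ) / 2) = -((3 : ℕ) : ℝ) by norm_num, Real.rpow_neg (by positivity),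
    Real.rpow_natCast]

/-- The density is ε⁻⁴ times a fixed function of v/ε, and the Jacobian ε⁴ of dimension four cancels
the factor. -/
theorem integrable_bubble {κ ε : ℝ} (hκ : 0 < κ) (hε : 0 < ε) :
    Integrable (fun v : E4 => ε ^ 2 / (ε ^ 2 + κ * ‖v‖ ^ 2) ^ 3) ∧
      ∫ v : E4, ε ^ 2 / (ε ^ 2 + κ * ‖v‖ ^ 2) ^ 3 = ∫ v : E4, ((1 + κ * ‖v‖ ^ 2) ^ 3)⁻¹ := by
  have e : (fun v : E4 => ε ^ 2 / (ε ^ 2 + κ * ‖v‖ ^ 2) ^ 3) = fun v : E4 =>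
      (ε ^ 4)⁻¹ * (fun v : E4 => ((1 + κ * ‖v‖ ^ 2) ^ 3)⁻¹) (ε⁻¹ • v) := by
    ext v
    have : 1 + κ * ‖ε⁻¹ • v‖ ^ 2 = (ε ^ 2)⁻¹ * (ε ^ 2 + κ * ‖v‖ ^ 2) := by
      rw [norm_smul, Real.norm_eq_abs, mul_pow, sq_abs]
      field_simp
    simp only [this]
    have h0 : 0 < ε ^ 2 + κ * ‖v‖ ^ 2 := by positivity
    field_simp
  rw [e]
  refine ⟨((integrable_inv_one_add_norm_sq hκ).comp_smul (inv_ne_zero hε.ne')).const_mul _, ?_⟩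
  rw [MeasureTheory.integral_const_mul,
    Measure.integral_comp_inv_smul volume (fun v : E4 => ((1 + κ * ‖v‖ ^ 2) ^ 3)⁻¹) ε]
  simp only [finrank_euclideanSpace, Fintype.card_fin, smul_eq_mul]
  rw [abs_of_pos (by positivity), inv_mul_cancel_left₀ (by positivity)]

/-- In polar coordinates the integral is that of y³ · y⁻⁴ = 1/y near zero. -/
theorem not_integrableOn_inv_norm_pow_four {δ : ℝ} (hδ : 0 < δ) :
    ¬ IntegrableOn (fun v : E4 => (‖v‖ ^ 4)⁻¹) (Metric.ball 0 δ) := by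
  intro h
  have h1 := (integrableOn_fun_norm_addHaar (E := E4) volume (f := fun y : ℝ => (y ^ 4)⁻¹)).1 h
  have h2 : IntegrableOn (fun y : ℝ => y ^ (-1 : ℝ)) (Set.Ioo 0 δ) := by
    refine h1.congr_fun (fun y hy => ?_) measurableSet_Ioo
    have : y ≠ 0 := hy.1.ne'
    simp only [finrank_euclideanSpace, Fintype.card_fin, smul_eq_mul, Real.rpow_neg_one]
    field_simp
  rw [intervalIntegral.integrableOn_Ioo_rpow_iff hδ] at h2
  exact lt_irrefl _ h2

section manifold
variable {M : Type*} [TopologicalSpace M] [ChartedSpace E4 M] [IsManifold (𝓡 4) ∞ M]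
  [T2Space M] [CompactSpace M]

namespace IsDistSqLike

variable {g : Metric4 M} {p : M} {ρ : M → ℝ}

omit [T2Space M] [CompactSpace M] in
theorem shift_pos (h : IsDistSqLike g p ρ) {ε : ℝ} (hε : 0 < ε) (c : M) (u : E4) :
    0 < ε ^ 2 + chartExpr ρ c u := by
  have : 0 ≤ chartExpr ρ c u := h.nonneg _
  positivity

omit [T2Space M] [CompactSpace M] in
theorem isContinuousFamily_div (h : IsDistSqLike g p ρ) {ε : ℝ} (hε : 0 < ε) (a : ℝ) (n : ℕ) :
    IsContinuousFamily fun c u => a / (ε ^ 2 + chartExpr ρ c u) ^ n := fun c =>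
  continuousOn_const.div ((continuousOn_const.add
    (isContinuousFamily_chartExpr h.smooth c)).pow n) fun u _ => (pow_pos (h.shift_pos hε c u) n).ne'

/-- In each chart ρ ≥ κ|u - u₀|² compares the integrand with a Euclidean bubble, whose integral does
not depend on ε. -/
theorem exists_forall_integral_bubble_le (h : IsDistSqLike g p ρ) :
    ∃ C, ∀ ε, 0 < ε → integral g (fun c u => ε ^ 2 / (ε ^ 2 + chartExpr ρ c u) ^ 3) ≤ C := by
  have key : ∀ c, ∃ C, ∀ ε, 0 < ε → ∫ u in (chartAt E4 c).target,
      chartWeight g c u * (ε ^ 2 / (ε ^ 2 + chartExpr ρ c u) ^ 3) ≤ C := by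
    intro c
    obtain ⟨u₀, κ, hκ, hle⟩ := h.exists_mul_norm_sq_le c
    obtain ⟨W, hW⟩ := (isCompact_chartSupport c).exists_bound_of_continuousOn
      ((continuousOn_chartWeight g c).mono (chartSupport_subset c))
    refine ⟨|W| * ∫ v : E4, ((1 + κ * ‖v‖ ^ 2) ^ 3)⁻¹, fun ε hε => ?_⟩
    obtain ⟨hi, he⟩ := integrable_bubble hκ hε
    have hi' := (hi.comp_sub_right u₀).const_mul |W|
    rw [← he, ← integral_sub_right_eq_self
      (fun v : E4 => ε ^ 2 / (ε ^ 2 + κ * ‖v‖ ^ 2) ^ 3) u₀, ← MeasureTheory.integral_const_mul]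
    refine (setIntegral_mono_on (integrableOn_chartWeight_mul g (h.isContinuousFamily_div hε _ 3) c)
      hi'.integrableOn (chartAt E4 c).open_target.measurableSet fun u hu => ?_).trans
      (setIntegral_le_integral hi' (Filter.Eventually.of_forall fun u => by positivity))
    by_cases hs : u ∈ chartSupport c
    · have h1 : chartWeight g c u ≤ |W| :=
        ((le_abs_self _).trans (hW u hs)).trans (le_abs_self _)
      have h2 := hle u hs
      have := h.shift_pos hε c u
      gcongr
    · rw [chartWeight_eq_zero g c hu hs, zero_mul]
      positivity
  choose C hC using key
  refine ⟨∑ c ∈ activeCharts M, C c, fun ε hε => ?_⟩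
  rw [integral_eq_sum]
  exact Finset.sum_le_sum fun c _ => hC c ε hε

/-- If the integrals stayed below N for all ε, Fatou's lemma along ε = 1/(n+1), together with ρ ≤
D|u - u₀|² near `p`, would make |u - u₀|⁻⁴ integrable on a ball of ℝ⁴. -/
theorem exists_le_integral_inv_sq (h : IsDistSqLike g p ρ) (N : ℝ) :
    ∃ ε, 0 < ε ∧ ε ≤ 1 ∧ N ≤ integral g (fun c u => 1 / (ε ^ 2 + chartExpr ρ c u) ^ 2) := by
  by_contra! hcon
  obtain ⟨c, hc, hp, hw⟩ := exists_chartWeight_pos g p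
  obtain ⟨V, hV, f, hf⟩ := h.local_form c hp
  have ht := (chartAt E4 c).map_source hp
  obtain ⟨C, hC⟩ := hf.le_eventually
  set u₀ := chartAt E4 c p
  have h2 : ∀ᶠ u in 𝓝 u₀, chartWeight g c u₀ / 2 < chartWeight g c u :=
    ((continuousOn_chartWeight g c).continuousAt
      ((chartAt E4 c).open_target.mem_nhds ht)).eventually (lt_mem_nhds (half_lt_self hw))
  obtain ⟨δ, hδ, hball⟩ := Metric.eventually_nhds_iff_ball.1
    ((hC.and h2).and ((chartAt E4 c).open_target.mem_nhds ht))
  set m := chartWeight g c u₀ / 2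
  have hm : 0 < m := half_pos hw
  set D := |C| + 1
  have hD : 0 < D := by positivity
  let ε : ℕ → ℝ := fun n => 1 / ((n : ℝ) + 1)
  have hε : ∀ n, 0 < ε n := fun n => Nat.one_div_pos_of_nat
  have hε1 : ∀ n, ε n ≤ 1 := fun n => by
    simp only [ε]; rw [div_le_one (by positivity)]; linarith [Nat.cast_nonneg (α := ℝ) n]
  let F : ℕ → E4 → ℝ := fun n u => m / (ε n ^ 2 + D * ‖u - u₀‖ ^ 2) ^ 2
  have hFpos : ∀ n u, 0 < ε n ^ 2 + D * ‖u - u₀‖ ^ 2 := fun n u => by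
    have := hε n; positivity
  have hFc : ∀ n, Continuous (F n) := fun n =>
    continuous_const.div (by fun_prop) fun u => (pow_pos (hFpos n u) 2).ne'
  have hF : ∀ n, ∫⁻ u in Metric.ball u₀ δ, ENNReal.ofReal (F n u) ≤ ENNReal.ofReal N := by
    intro n
    have hint : IntegrableOn (F n) (Metric.ball u₀ δ) :=
      ((hFc n).continuousOn.integrableOn_compact (isCompact_closedBall u₀ δ)).mono_set
        Metric.ball_subset_closedBall
    rw [← ofReal_integral_eq_lintegral_ofReal hint
      (Filter.Eventually.of_forall fun u => by have := hFpos n u; positivity)]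
    refine ENNReal.ofReal_le_ofReal (le_trans ?_ (hcon (ε n) (hε n) (hε1 n)).le)
    refine le_trans ?_ (le_integral g (fun c u _ => by
      have := h.shift_pos (hε n) c u; positivity) hc)
    have hI := integrableOn_chartWeight_mul g (h.isContinuousFamily_div (hε n) 1 2) c
    have hsub : Metric.ball u₀ δ ⊆ (chartAt E4 c).target := fun u hu => (hball u hu).2
    refine le_trans (setIntegral_mono_on hint (hI.mono_set hsub) measurableSet_ball
      fun u hu => ?_) (setIntegral_mono_set hI ?_ hsub.eventuallyLE)
    · obtain ⟨⟨h3, h4⟩, -⟩ := hball u hu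
      have h5 : chartExpr ρ c u ≤ D * ‖u - u₀‖ ^ 2 :=
        le_trans h3 (by gcongr; exact (le_abs_self C).trans (by simp [D]))
      have := h.shift_pos (hε n) c u
      simp only [F]
      rw [mul_one_div]
      gcongr
      exact chartWeight_nonneg g c u
    · refine Filter.Eventually.of_forall fun u => ?_
      have := h.shift_pos (hε n) c u
      exact mul_nonneg (chartWeight_nonneg g c u) (by positivity)
  have hlim : ∀ u, ENNReal.ofReal (m / D ^ 2 * (‖u - u₀‖ ^ 4)⁻¹) ≤
      Filter.liminf (fun n => ENNReal.ofReal (F n u)) Filter.atTop := by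
    intro u
    by_cases hu : u = u₀
    -- At the centre the left side is zero, since the inverse of 0 is 0 by convention.
    · simp [hu]
    · have hn : 0 < ‖u - u₀‖ := norm_pos_iff.2 (sub_ne_zero.2 hu)
      have ht0 : Filter.Tendsto ε Filter.atTop (𝓝 0) := tendsto_one_div_add_atTop_nhds_zero_nat
      have : Filter.Tendsto (fun n => F n u) Filter.atTop
          (𝓝 (m / (0 ^ 2 + D * ‖u - u₀‖ ^ 2) ^ 2)) :=
        tendsto_const_nhds.div (((ht0.pow 2).add tendsto_const_nhds).pow 2) (by positivity)
      rw [(ENNReal.tendsto_ofReal this).liminf_eq]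
      refine le_of_eq (congrArg _ ?_)
      field_simp
      ring
  have hfin : ∫⁻ u in Metric.ball u₀ δ, ENNReal.ofReal (m / D ^ 2 * (‖u - u₀‖ ^ 4)⁻¹) < ⊤ := by
    refine lt_of_le_of_lt ?_ (ENNReal.ofReal_lt_top (r := N))
    calc _ ≤ ∫⁻ u in Metric.ball u₀ δ,
          Filter.liminf (fun n => ENNReal.ofReal (F n u)) Filter.atTop := lintegral_mono hlim
      _ ≤ Filter.liminf (fun n => ∫⁻ u in Metric.ball u₀ δ, ENNReal.ofReal (F n u))
          Filter.atTop := lintegral_liminf_le fun n => (hFc n).measurable.ennreal_ofReal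
      _ ≤ _ := (Filter.liminf_le_liminf (Filter.Eventually.of_forall hF)).trans_eq
          (Filter.liminf_const _)
  have hmeas : Measurable fun u : E4 => m / D ^ 2 * (‖u - u₀‖ ^ 4)⁻¹ := by fun_prop
  have hint : IntegrableOn (fun u : E4 => m / D ^ 2 * (‖u - u₀‖ ^ 4)⁻¹) (Metric.ball u₀ δ) := by
    refine ⟨hmeas.aestronglyMeasurable, ?_⟩
    rw [hasFiniteIntegral_iff_ofReal (Filter.Eventually.of_forall fun u => by positivity)]
    exact hfin
  have hint2 : IntegrableOn (fun u : E4 => (‖u - u₀‖ ^ 4)⁻¹) (Metric.ball u₀ δ) := by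
    have := hint.const_mul (m / D ^ 2)⁻¹
    refine this.congr (Filter.Eventually.of_forall fun u => ?_)
    have : m / D ^ 2 ≠ 0 := by positivity
    simp only
    rw [inv_mul_cancel_left₀ this]
  refine not_integrableOn_inv_norm_pow_four hδ ?_
  rw [← (measurePreserving_sub_right volume u₀).integrableOn_comp_preimage
    (MeasurableEquiv.subRight u₀).measurableEmbedding]
  have : (fun u : E4 => u - u₀) ⁻¹' Metric.ball 0 δ = Metric.ball u₀ δ := by
    ext u; simp [dist_eq_norm]
  rw [this]
  exact hint2

end IsDistSqLike
end manifold

/-! ### Pointwise upper bound for the density of the concentrating family. -/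

theorem exists_leading_coefficient_neg {γ₂ γ₃ : ℝ} (hγ : γ₂ + 3 * γ₃ < 0) :
    ∃ η > 0, ∀ A y : ℝ, |A - 8| < η → |y - 4| < η →
      γ₂ * ((A - y) / 2) ^ 2 + 12 * γ₃ * (3 * y / 4 - A / 2) ^ 2 ≤ 3 * (γ₂ + 3 * γ₃) := by
  have hc : Continuous fun q : ℝ × ℝ =>
      γ₂ * ((q.1 - q.2) / 2) ^ 2 + 12 * γ₃ * (3 * q.2 / 4 - q.1 / 2) ^ 2 := by fun_prop
  -- At (8, 4) the expression equals 4(γ₂ + 3γ₃), strictly below 3(γ₂ + 3γ₃) because the sum is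
  -- negative.
  have := hc.continuousAt.eventually_lt (x₀ := ((8 : ℝ), (4 : ℝ)))
    (continuousAt_const (y := 3 * (γ₂ + 3 * γ₃))) (by norm_num; linarith)
  obtain ⟨η, hη, H⟩ := Metric.eventually_nhds_iff.1 this
  refine ⟨η, hη, fun A y hA hy => (H (y := (A, y)) ?_).le⟩
  rw [Prod.dist_eq, max_lt_iff]
  exact ⟨by simpa [Real.dist_eq] using hA, by simpa [Real.dist_eq] using hy⟩

/-- Put s = ε² + r and y = B/s. Three regions occur: for r ≥ δ everything is bounded; for r < δ and
ε²/s not small, 1/s² is dominated by ε²/s³; otherwise y - 4 = (B - 4r)/s - 4ε²/s is small and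
`exists_leading_coefficient_neg` applies. -/
theorem leading_term_le {γ₂ γ₃ : ℝ} (hγ : γ₂ + 3 * γ₃ < 0) (hγ₃ : 0 < γ₃) :
    ∃ η > 0, ∀ δ > 0, ∀ K ≥ 0, ∃ C ≥ 0, ∀ A B r ε : ℝ, 0 < ε → 0 ≤ r → |A| ≤ K → 0 ≤ B →
      B ≤ K * r → (r < δ → |A - 8| ≤ η ∧ |B - 4 * r| ≤ η * r) →
      (γ₂ * ((A - B / (ε ^ 2 + r)) / 2) ^ 2
        + 12 * γ₃ * (3 * (B / (ε ^ 2 + r)) / 4 - A / 2) ^ 2) / (ε ^ 2 + r) ^ 2 ≤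
      3 * (γ₂ + 3 * γ₃) / (ε ^ 2 + r) ^ 2 + C * (ε ^ 2 / (ε ^ 2 + r) ^ 3) + C := by
  obtain ⟨η₀, hη₀, H⟩ := exists_leading_coefficient_neg hγ
  refine ⟨η₀ / 4, by positivity, fun δ hδ K hK => ?_⟩
  set κ := -(γ₂ + 3 * γ₃) with hκ
  have hκ0 : 0 < κ := by linarith
  -- Since γ₂ < 0 and |3y/4 - A/2| ≤ 2K, the numerator is at most 48 γ₃ K². The extra 3κ pays for
  -- inserting the negative main term where it is not available.
  set P := 48 * γ₃ * K ^ 2 + 3 * κ with hP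
  have hP0 : 0 ≤ P := by positivity
  refine ⟨max (P / δ ^ 2) (P * (8 / η₀)), by positivity, fun A B r ε hε hr hA hB hBr hnear => ?_⟩
  set s := ε ^ 2 + r with hs
  have hs0 : 0 < s := by positivity
  have hrs : r ≤ s := by rw [hs]; linarith [sq_nonneg ε]
  set y := B / s with hy
  have hy0 : 0 ≤ y := by positivity
  have hyK : y ≤ K := by
    rw [hy, div_le_iff₀ hs0]; exact hBr.trans (by gcongr)
  set Ψ := γ₂ * ((A - y) / 2) ^ 2 + 12 * γ₃ * (3 * y / 4 - A / 2) ^ 2 with hΨ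
  have hΨP : Ψ ≤ P - 3 * κ := by
    have h1 : γ₂ * ((A - y) / 2) ^ 2 ≤ 0 :=
      mul_nonpos_of_nonpos_of_nonneg (by linarith) (sq_nonneg _)
    have h2 : (3 * y / 4 - A / 2) ^ 2 ≤ (2 * K) ^ 2 := by
      refine sq_le_sq' ?_ ?_ <;> linarith [(abs_le.1 hA).1, (abs_le.1 hA).2]
    have h3 : 12 * γ₃ * (3 * y / 4 - A / 2) ^ 2 ≤ 12 * γ₃ * (2 * K) ^ 2 := by gcongr
    rw [hΨ, hP]; nlinarith
  have e0 : 0 ≤ ε ^ 2 / s ^ 3 := by positivity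
  have hC1 : P / δ ^ 2 ≤ max (P / δ ^ 2) (P * (8 / η₀)) := le_max_left _ _
  have hC2 : P * (8 / η₀) ≤ max (P / δ ^ 2) (P * (8 / η₀)) := le_max_right _ _
  have hC0 : 0 ≤ max (P / δ ^ 2) (P * (8 / η₀)) := by positivity
  set C := max (P / δ ^ 2) (P * (8 / η₀))
  have hneg : 3 * (γ₂ + 3 * γ₃) = -(3 * κ) := by rw [hκ]; ring
  rw [hneg]
  have hbd : Ψ / s ^ 2 ≤ -(3 * κ) / s ^ 2 + P / s ^ 2 := by
    rw [← add_div]; gcongr; linarith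
  by_cases hrδ : r < δ
  · obtain ⟨hA8, hB4⟩ := hnear hrδ
    by_cases hε8 : ε ^ 2 / s < η₀ / 8
    · have hy4 : |y - 4| < η₀ := by
        have e : y - 4 = (B - 4 * r) / s - 4 * (ε ^ 2 / s) := by
          rw [hy, hs]; field_simp; ring
        have h1 : |(B - 4 * r) / s| ≤ η₀ / 4 := by
          rw [abs_div, abs_of_pos hs0, div_le_iff₀ hs0]
          exact hB4.trans (by gcongr)
        have h2 : 0 ≤ ε ^ 2 / s := by positivity
        rw [e, abs_lt]
        constructor <;> linarith [(abs_le.1 h1).1, (abs_le.1 h1).2]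
      have := H A y (lt_of_le_of_lt hA8 (by linarith)) hy4
      rw [hneg] at this
      have h1 : Ψ / s ^ 2 ≤ -(3 * κ) / s ^ 2 := by gcongr
      have h2 : 0 ≤ C * (ε ^ 2 / s ^ 3) := by positivity
      linarith
    · have h1 : P / s ^ 2 ≤ C * (ε ^ 2 / s ^ 3) := by
        have h2 : 1 ≤ 8 / η₀ * (ε ^ 2 / s) := by
          rw [not_lt] at hε8
          calc (1 : ℝ) = 8 / η₀ * (η₀ / 8) := by field_simp
            _ ≤ _ := by gcongr
        calc P / s ^ 2 = P / s ^ 2 * 1 := by ring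
          _ ≤ P / s ^ 2 * (8 / η₀ * (ε ^ 2 / s)) := by gcongr
          _ = P * (8 / η₀) * (ε ^ 2 / s ^ 3) := by field_simp
          _ ≤ _ := by gcongr
      linarith
  · have h1 : P / s ^ 2 ≤ C := by
      refine le_trans ?_ hC1
      have : δ ≤ s := (not_lt.1 hrδ).trans hrs
      gcongr
    have h2 : 0 ≤ C * (ε ^ 2 / s ^ 3) := by positivity
    linarith

theorem abs_log_le_add_inv {s : ℝ} (hs : 0 < s) : |Real.log s| ≤ s + 1 / s := by
  have h1 := Real.log_le_self hs.le
  have h2 := Real.log_le_self (inv_pos.2 hs).le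
  rw [Real.log_inv] at h2
  have h3 : 0 < s⁻¹ := inv_pos.2 hs
  rw [one_div, abs_le]
  constructor <;> linarith

/-- Pointwise upper bound for the density of the functional at `w = -(1/2) log (ε² + ρ)`; here
`A`, `B`, `T` and `r` stand for `Δρ`, `|∇ρ|²`, `Ric(∇ρ, ∇ρ)` and `ρ`. -/
theorem density_le {γ₂ γ₃ : ℝ} (hγ : γ₂ + 3 * γ₃ < 0) (hγ₃ : 0 < γ₃) :
    ∃ η > 0, ∀ δ > 0, ∀ K ≥ 0, ∃ C ≥ 0, ∀ A B T r R z ε : ℝ, 0 < ε → ε ≤ 1 → 0 ≤ r → r ≤ K →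
      |A| ≤ K → 0 ≤ B → B ≤ K * r → |T| ≤ K * r → |R| ≤ K → |z| ≤ K →
      (r < δ → |A - 8| ≤ η ∧ |B - 4 * r| ≤ η * r) → ∀ a b τ w : ℝ,
      a = -(1 / 2) / (ε ^ 2 + r) * A + 1 / 2 / (ε ^ 2 + r) ^ 2 * B →
      b = (-(1 / 2) / (ε ^ 2 + r)) ^ 2 * B → τ = (-(1 / 2) / (ε ^ 2 + r)) ^ 2 * T →
      w = -(1 / 2) * Real.log (ε ^ 2 + r) →
      γ₂ * (a ^ 2 + 2 / 3 * R * b - 2 * τ) + 12 * γ₃ * (a + b) ^ 2 - 4 * γ₃ * (R * b) + z * w ≤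
        2 * (γ₂ + 3 * γ₃) * (1 / (ε ^ 2 + r) ^ 2) + C * (ε ^ 2 / (ε ^ 2 + r) ^ 3) + C * 1 := by
  obtain ⟨η, hη, H⟩ := leading_term_le hγ hγ₃
  refine ⟨η, hη, fun δ hδ K hK => ?_⟩
  obtain ⟨C₁, hC₁, H₁⟩ := H δ hδ K hK
  set κ := -(γ₂ + 3 * γ₃) with hκ
  have hκ0 : 0 < κ := by linarith
  set L := (|γ₂| + 4 * γ₃) * K * K + |γ₂| * K + K * (K + 2) with hL
  have hL0 : 0 ≤ L := by positivity
  -- The lower-order terms are at most Lx + L with x = 1/s, and Lx ≤ κx² + L²/(4κ). Absorbing κx²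
  -- lowers the coefficient of γ₂ + 3γ₃ from 3 to 2.
  refine ⟨C₁ + L + L ^ 2 / (4 * κ), by positivity, ?_⟩
  intro A B T r R z ε hε hε1 hr hrK hA hB hBr hT hR hz hnear a b τ w ha hb hτ hw
  have hmain := H₁ A B r ε hε hr hA hB hBr hnear
  set s := ε ^ 2 + r with hs
  have hs0 : 0 < s := by positivity
  have hrs : r ≤ s := by rw [hs]; linarith [sq_nonneg ε]
  have hsK : s ≤ K + 1 := by
    have : ε ^ 2 ≤ 1 := pow_le_one₀ hε.le hε1
    rw [hs]; linarith
  have elead : γ₂ * a ^ 2 + 12 * γ₃ * (a + b) ^ 2 =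
      (γ₂ * ((A - B / s) / 2) ^ 2 + 12 * γ₃ * (3 * (B / s) / 4 - A / 2) ^ 2) / s ^ 2 := by
    rw [ha, hb]; field_simp; ring
  have hscale : ∀ X : ℝ, |X| ≤ K * r → |(-(1 / 2) / s) ^ 2 * X| ≤ K * (1 / s) / 4 := by
    intro X hX
    rw [abs_mul, abs_of_nonneg (sq_nonneg _)]
    calc (-(1 / 2) / s) ^ 2 * |X| ≤ (-(1 / 2) / s) ^ 2 * (K * s) := by
          gcongr; exact hX.trans (by gcongr)
      _ = K * (1 / s) / 4 := by field_simp; ring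
  have hx0 : 0 < 1 / s := by positivity
  set x := 1 / s with hx
  have hb' : |b| ≤ K * x / 4 := hb ▸ hscale B (by rwa [abs_of_nonneg hB])
  have hτ' : |τ| ≤ K * x / 4 := hτ ▸ hscale T hT
  have hRb : |R * b| ≤ K * (K * x / 4) := by rw [abs_mul]; gcongr
  have hzw : |z * w| ≤ K * (K + 1 + x) := by
    rw [abs_mul]
    have : |w| ≤ K + 1 + x := by
      rw [hw, abs_mul]
      have h1 := abs_log_le_add_inv hs0
      have h2 : |(-(1 / 2) : ℝ)| = 1 / 2 := by norm_num
      rw [h2]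
      rw [← hx] at h1
      linarith [abs_nonneg (Real.log s)]
    gcongr
  have t1 : (γ₂ * (2 / 3) - 4 * γ₃) * (R * b) ≤ (|γ₂| + 4 * γ₃) * (K * (K * x / 4)) := by
    refine (le_abs_self _).trans ?_
    rw [abs_mul]
    gcongr
    refine (abs_sub _ _).trans ?_
    rw [abs_mul, abs_of_pos (by positivity : 0 < 4 * γ₃), abs_of_pos (by norm_num : (0 : ℝ) < 2 / 3)]
    linarith [abs_nonneg γ₂]
  have t2 : -(2 * γ₂) * τ ≤ 2 * |γ₂| * (K * x / 4) := by
    refine (le_abs_self _).trans ?_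
    rw [abs_mul, abs_neg, abs_mul, abs_of_pos (by norm_num : (0 : ℝ) < 2)]
    gcongr
  have t3 : z * w ≤ K * (K + 1 + x) := (le_abs_self _).trans hzw
  have tlow : (γ₂ * (2 / 3) - 4 * γ₃) * (R * b) + -(2 * γ₂) * τ + z * w ≤ L * x + L := by
    have n1 : 0 ≤ |γ₂| * K := by positivity
    have n2 : 0 ≤ (|γ₂| + 4 * γ₃) * K * K := by positivity
    have n3 : 0 ≤ |γ₂| * K * x := by positivity
    have n4 : 0 ≤ (|γ₂| + 4 * γ₃) * K * K * x := by positivity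
    have n5 : 0 ≤ K * (K + 1) * x := by positivity
    rw [hL]
    linarith
  have habs : L * x ≤ κ * x ^ 2 + L ^ 2 / (4 * κ) := by
    have : κ * x ^ 2 + L ^ 2 / (4 * κ) - L * x = (2 * κ * x - L) ^ 2 / (4 * κ) := by
      field_simp; ring
    have : 0 ≤ (2 * κ * x - L) ^ 2 / (4 * κ) := by positivity
    linarith
  have hx2 : 1 / s ^ 2 = x ^ 2 := by rw [hx]; field_simp
  have hdiv : 3 * (γ₂ + 3 * γ₃) / s ^ 2 = -(3 * κ) * x ^ 2 := by
    rw [hx, hκ]; field_simp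
  rw [← elead, hdiv] at hmain
  rw [hx2]
  have hκ' : 2 * (γ₂ + 3 * γ₃) = -(2 * κ) := by rw [hκ]; ring
  rw [hκ']
  have hq : C₁ * (ε ^ 2 / s ^ 3) ≤ (C₁ + L + L ^ 2 / (4 * κ)) * (ε ^ 2 / s ^ 3) := by
    gcongr
    have : 0 ≤ L ^ 2 / (4 * κ) := by positivity
    linarith
  have eall : γ₂ * (a ^ 2 + 2 / 3 * R * b - 2 * τ) + 12 * γ₃ * (a + b) ^ 2 - 4 * γ₃ * (R * b)
      + z * w = (γ₂ * a ^ 2 + 12 * γ₃ * (a + b) ^ 2) +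
        ((γ₂ * (2 / 3) - 4 * γ₃) * (R * b) + -(2 * γ₂) * τ + z * w) := by ring
  rw [eall]
  linarith

theorem deriv_half_log (e : ℝ) : deriv (fun x => -(1 / 2) * Real.log (e + x)) =
    fun x => -(1 / 2) / (e + x) := by
  ext x
  rw [deriv_const_mul_field, deriv_comp_const_add, Real.deriv_log, ← div_eq_mul_inv]

theorem deriv_deriv_half_log (e : ℝ) : deriv (deriv fun x => -(1 / 2) * Real.log (e + x)) =
    fun x => 1 / 2 / (e + x) ^ 2 := by
  rw [deriv_half_log]
  ext x
  simp only [div_eq_mul_inv (-(1 / 2) : ℝ)]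
  rw [deriv_const_mul_field, deriv_comp_const_add (f := fun y : ℝ => y⁻¹), deriv_inv]
  ring

/-- The logarithm is o(J), so the linear term wins whatever the sign and size of Λ. -/
theorem exists_add_log_le {κ : ℝ} (hκ : 0 < κ) (Λ V D N : ℝ) (hV : 0 < V) :
    ∃ X > 0, ∀ J ≥ X, -κ * J + D + Λ * Real.log (J / V) ≤ N := by
  have h1 := Real.isLittleO_log_id_atTop.bound (c := κ / (2 * (|Λ| + 1))) (by positivity)
  obtain ⟨X, hX⟩ := Filter.eventually_atTop.1 (h1.and
    (Filter.eventually_ge_atTop (2 / κ * (D + |Λ| * |Real.log V| + |N|))))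
  refine ⟨max X 1, by positivity, fun J hJ => ?_⟩
  have hJ1 : 1 ≤ J := (le_max_right _ _).trans hJ
  obtain ⟨h2, h3⟩ := hX J ((le_max_left _ _).trans hJ)
  have hJ0 : 0 < J := by linarith
  simp only [id, Real.norm_eq_abs, abs_of_pos hJ0] at h2
  rw [Real.log_div hJ0.ne' hV.ne']
  have h4 : Λ * (Real.log J - Real.log V) ≤ |Λ| * |Real.log J| + |Λ| * |Real.log V| := by
    refine (le_abs_self _).trans ?_
    rw [abs_mul, ← mul_add]
    gcongr
    exact abs_sub _ _
  have h5 : |Λ| * |Real.log J| ≤ κ / 2 * J := by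
    calc |Λ| * |Real.log J| ≤ (|Λ| + 1) * (κ / (2 * (|Λ| + 1)) * J) := by gcongr; linarith
      _ = κ / 2 * J := by field_simp
  have h6 : D + |Λ| * |Real.log V| + |N| ≤ κ / 2 * J := by
    calc _ = κ / 2 * (2 / κ * (D + |Λ| * |Real.log V| + |N|)) := by field_simp
      _ ≤ _ := by gcongr
  have := neg_abs_le N
  linarith

theorem iInf_coe_eq_bot {ι : Type*} {F : ι → ℝ} (hF : ∀ N : ℝ, ∃ w, F w ≤ N) :
    ⨅ w, (F w : EReal) = ⊥ := by
  rw [iInf_eq_bot]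
  intro b hb
  induction b with
  | bot => exact absurd hb (lt_irrefl _)
  | coe b =>
    obtain ⟨w, hw⟩ := hF (b - 1)
    exact ⟨w, EReal.coe_lt_coe_iff.2 (by linarith)⟩
  | top => exact ⟨_, EReal.coe_lt_top (F (hF 0).choose)⟩

theorem iSup_coe_eq_top {ι : Type*} {F : ι → ℝ} (hF : ∀ N : ℝ, ∃ w, N ≤ F w) :
    ⨆ w, (F w : EReal) = ⊤ := by
  rw [iSup_eq_top]
  intro b hb
  induction b with
  | bot => exact ⟨_, EReal.bot_lt_coe (F (hF 0).choose)⟩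
  | coe b =>
    obtain ⟨w, hw⟩ := hF (b + 1)
    exact ⟨w, EReal.coe_lt_coe_iff.2 (by linarith)⟩
  | top => exact absurd hb (lt_irrefl _)

/-! ### Unboundedness from below and conclusion. -/

section manifold
variable {M : Type*} [TopologicalSpace M] [ChartedSpace E4 M] [IsManifold (𝓡 4) ∞ M]
  [T2Space M] [CompactSpace M]

/-- Along the concentrating family `w = -(1/2) log (ε² + ρ)` the functional tends to `-∞`. -/
theorem exists_smoothFunctional_le [Nonempty M] {γ₂ γ₃ Λ : ℝ} (hγ : γ₂ + 3 * γ₃ < 0)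
    (hγ₃ : 0 < γ₃) {Z : M → E4 → ℝ} (hZ : IsContinuousFamily Z) (g : Metric4 M) (N : ℝ) :
    ∃ w, ∃ _ : ContMDiff (𝓡 4) 𝓘(ℝ, ℝ) ∞ w, smoothFunctional γ₂ γ₃ Λ Z g w ≤ N := by
  obtain ⟨ρ, h⟩ := exists_isDistSqLike g (Classical.arbitrary M)
  have hA := isContinuousFamily_lapOf g h.smooth
  have hR := isContinuousFamily_scal g
  have hx := isContinuousFamily_chartExpr h.smooth
  obtain ⟨K, ⟨⟨⟨⟨⟨⟨hKA, hKB⟩, hKT⟩, hKR⟩, hKZ⟩, hKx⟩, hK0⟩⟩ :=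
    ((((((eventually_abs_le hA).and h.eventually_gradSqOf_le).and
      h.eventually_abs_ricGradOf_le).and (eventually_abs_le hR)).and (eventually_abs_le hZ)).and
      (eventually_abs_le hx)).and (Filter.eventually_ge_atTop 0) |>.exists
  obtain ⟨η, hη, H⟩ := density_le hγ hγ₃
  obtain ⟨δ, hδ, hnear⟩ := h.exists_near hη
  obtain ⟨C, hC0, hC⟩ := H δ hδ K hK0
  obtain ⟨D, hD⟩ := h.exists_forall_integral_bubble_le
  set V := integral g fun _ _ => 1 with hV
  have hV0 : 0 < V := volume_pos g
  -- The constants C and D are independent of ε, so the threshold X for J can be fixed before ε is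
  -- chosen.
  obtain ⟨X, hX0, hX⟩ := exists_add_log_le (κ := -(2 * (γ₂ + 3 * γ₃))) (by linarith) Λ V
    (C * D + C * V) N hV0
  obtain ⟨ε, hε, hε1, hJ⟩ := h.exists_le_integral_inv_sq X
  have hs : ∀ x, 0 < ε ^ 2 + ρ x := fun x => by have := h.nonneg x; positivity
  have hsm : ContDiffOn ℝ ∞ (fun x => -(1 / 2) * Real.log (ε ^ 2 + x)) (Set.Ioi (-ε ^ 2)) := by
    refine contDiffOn_const.mul ((contDiffOn_const.add contDiffOn_id).log fun x hx => ?_)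
    have : -ε ^ 2 < x := hx
    exact (by simp only [id]; linarith : 0 < ε ^ 2 + id x).ne'
  have hρI : ∀ x, ρ x ∈ Set.Ioi (-ε ^ 2) := fun x => by
    have := hs x; simp only [Set.mem_Ioi]; linarith
  set w : M → ℝ := fun x => -(1 / 2) * Real.log (ε ^ 2 + ρ x) with hw
  have hws : ContMDiff (𝓡 4) 𝓘(ℝ, ℝ) ∞ w :=
    contMDiff_comp_of_contDiffOn h.smooth isOpen_Ioi hsm hρI
  refine ⟨w, hws, ?_⟩
  -- The factor -1/2 in `w` gives e^{4w} = (ε² + ρ)⁻², so the integral inside the logarithm is the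
  -- same J as in the main term.
  have hmean : (mean g fun c u => Real.exp (4 * chartExpr w c u)) =
      integral g (fun c u => 1 / (ε ^ 2 + chartExpr ρ c u) ^ 2) / V := by
    rw [mean]
    congr 1
    refine integral_congr g fun c u _ => ?_
    have h0 := h.shift_pos hε c u
    have e : 4 * chartExpr w c u = -(Real.log ((ε ^ 2 + chartExpr ρ c u) ^ 2)) := by
      rw [Real.log_pow]
      simp only [chartExpr, hw]
      push_cast; ring
    rw [e, Real.exp_neg, Real.exp_log (by positivity), one_div]
  have k₁ := h.isContinuousFamily_div hε 1 2
  have k₂ := h.isContinuousFamily_div hε (ε ^ 2) 3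
  have hAw := isContinuousFamily_lapOf g hws
  have hBw := isContinuousFamily_gradSqOf g hws
  have hTw := isContinuousFamily_ricGradOf g hws
  have hxw := isContinuousFamily_chartExpr hws
  have hle := integral_mono g (f := fun c u =>
      γ₂ * (lapOf g w c u ^ 2 + 2 / 3 * scal (metricMatrix g c) u * gradSqOf g w c u
        - 2 * ricGradOf g w c u)
      + 12 * γ₃ * (lapOf g w c u + gradSqOf g w c u) ^ 2
      - 4 * γ₃ * (scal (metricMatrix g c) u * gradSqOf g w c u) + Z c u * chartExpr w c u)
    (h := fun c u => 2 * (γ₂ + 3 * γ₃) * (1 / (ε ^ 2 + chartExpr ρ c u) ^ 2) +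
      C * (ε ^ 2 / (ε ^ 2 + chartExpr ρ c u) ^ 3) + C * 1 + 0 * 0)
    (fun c => (((continuousOn_const.mul ((((hAw c).pow 2).add ((continuousOn_const.mul
        (hR c)).mul (hBw c))).sub (continuousOn_const.mul (hTw c)))).add
        (continuousOn_const.mul (((hAw c).add (hBw c)).pow 2))).sub
        (continuousOn_const.mul ((hR c).mul (hBw c)))).add ((hZ c).mul (hxw c)))
    (fun c => (((continuousOn_const.mul (k₁ c)).add (continuousOn_const.mul (k₂ c))).add
      continuousOn_const).add continuousOn_const) fun c u hu => by
    have ht := chartSupport_subset c hu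
    have e1 := lapOf_comp g h.smooth isOpen_Ioi hsm hρI ht
    have e2 := gradSqOf_comp g h.smooth isOpen_Ioi hsm hρI ht
    have e3 := ricGradOf_comp g h.smooth isOpen_Ioi hsm hρI ht
    rw [deriv_deriv_half_log, deriv_half_log] at e1
    rw [deriv_half_log] at e2 e3
    have := hC (lapOf g ρ c u) (gradSqOf g ρ c u) (ricGradOf g ρ c u) (chartExpr ρ c u)
      (scal (metricMatrix g c) u) (Z c u) ε hε hε1 (h.nonneg _)
      ((le_abs_self _).trans (hKx c u hu)) (hKA c u hu) (gradSqOf_nonneg g ρ ht) (hKB c u hu)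
      (hKT c u hu) (hKR c u hu) (hKZ c u hu) (hnear c u hu) _ _ _ _ e1 e2 e3 rfl
    rw [zero_mul, add_zero]
    exact this
  rw [integral_linear_combination g _ _ _ _ k₁ k₂ (isContinuousFamily_const 1)
    (isContinuousFamily_const 0)] at hle
  rw [smoothFunctional, hmean]
  have h1 := hX _ hJ
  have h2 : C * integral g (fun c u => ε ^ 2 / (ε ^ 2 + chartExpr ρ c u) ^ 3) ≤ C * D := by
    have := hD ε hε
    gcongr
  rw [neg_neg] at h1
  linarith

/-- A functional given by `smoothFunctional` on smooth functions is unbounded in both directions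
if `γ₃ > 0` and `γ₂ + 3 γ₃ < 0`. -/
theorem unbounded_of_eq_smoothFunctional [Nonempty M] {γ₂ γ₃ : ℝ} (hγ : γ₂ + 3 * γ₃ < 0)
    (hγ₃ : 0 < γ₃) (g : Metric4 M) {F : W22 M → ℝ}
    (hF : ∃ (Λ : ℝ) (Z : M → E4 → ℝ), IsContinuousFamily Z ∧
      ∀ w (hw : ContMDiff (𝓡 4) 𝓘(ℝ, ℝ) ∞ w),
        F (W22.ofSmooth w hw) = smoothFunctional γ₂ γ₃ Λ Z g w) :
    (⨅ w, (F w : EReal)) = ⊥ ∧ (⨆ w, (F w : EReal)) = ⊤ := by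
  obtain ⟨Λ, Z, hZ, hF⟩ := hF
  refine ⟨iInf_coe_eq_bot fun N => ?_, iSup_coe_eq_top fun N => ?_⟩
  · obtain ⟨w, hw, hle⟩ := exists_smoothFunctional_le (Λ := Λ) hγ hγ₃ hZ g N
    exact ⟨W22.ofSmooth w hw, (hF w hw).trans_le hle⟩
  · obtain ⟨w, hw, hle⟩ := exists_le_smoothFunctional (γ₂ := γ₂) (Λ := Λ) hγ₃ hZ g N
    exact ⟨W22.ofSmooth w hw, hle.trans_eq (hF w hw).symm⟩

end manifold

end ConformalFour

theorem theorem1p2 {M : Type*} [TopologicalSpace M] [T2Space M] [CompactSpace M] [Nonempty M]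
    [ChartedSpace (EuclideanSpace ℝ (Fin 4)) M] [IsManifold (𝓡 4) ∞ M]
    (g : Bundle.ContMDiffRiemannianMetric (𝓡 4) ∞ (EuclideanSpace ℝ (Fin 4))
      (fun x : M => TangentSpace (𝓡 4) x)) :
    ((⨅ w : ConformalFour.W22 M, (ConformalFour.FP g w : EReal)) = ⊥ ∧
      (⨆ w : ConformalFour.W22 M, (ConformalFour.FP g w : EReal)) = ⊤) ∧
    ((⨅ w : ConformalFour.W22 M, (ConformalFour.Fτ g w : EReal)) = ⊥ ∧
      (⨆ w : ConformalFour.W22 M, (ConformalFour.Fτ g w : EReal)) = ⊤) ∧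
    ((⨅ w : ConformalFour.W22 M, (ConformalFour.FP' g w : EReal)) = ⊥ ∧
      (⨆ w : ConformalFour.W22 M, (ConformalFour.FP' g w : EReal)) = ⊤) ∧
    ((⨅ w : ConformalFour.W22 M, (ConformalFour.Fτ' g w : EReal)) = ⊥ ∧
      (⨆ w : ConformalFour.W22 M, (ConformalFour.Fτ' g w : EReal)) = ⊤) := by
  exact ⟨ConformalFour.unbounded_of_eq_smoothFunctional (by norm_num) (by norm_num) g
      (ConformalFour.detFunctional_ofSmooth _ _ _ g),
    ConformalFour.unbounded_of_eq_smoothFunctional (by norm_num) (by norm_num) g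
      (ConformalFour.detFunctional_ofSmooth _ _ _ g),
    ConformalFour.unbounded_of_eq_smoothFunctional (by norm_num) (by norm_num) g
      (ConformalFour.detFunctional'_ofSmooth _ _ _ g),
    ConformalFour.unbounded_of_eq_smoothFunctional (by norm_num) (by norm_num) g
      (ConformalFour.detFunctional'_ofSmooth _ _ _ g)⟩
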